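/- Let $\|\cdot\|$ be a norm on $\mathbb R^2$ whose closed unit ball is strictly convex and which is real analytic on $\mathbb R^2\setminus\{0\}$. Let $\partial\mathsf B=\{z\colon\|z\|=1\}$, let $L$ be its (Euclidean) length, let $\gamma\colon\mathbb R/L\mathbb Z\to\partial\mathsf B$ be a counterclockwise arc-length parametrization of $\partial\mathsf B$, and let $\alpha\colon\mathbb R\to\mathbb R$ be continuous with $\gamma'(\theta)=e^{i\alpha(\theta)}$ for all $\theta$ (identifying $\mathbb R^2$ with $\mathbb C$). Define $\Pi\colon\partial\mathsf B\times\partial\mathsf B\to[0,\infty)$ by $$\Pi(\gamma(\theta_1),\gamma(\theta_2))=\int_{\theta_1}^{\theta_2}\int_{\theta_1}^{\theta_2}|\alpha(t)-\alpha(s)|\,dt\,ds\qquad\text{for }|\theta_1-\theta_2|\le L/2 .$$ Let $\mathrm{ENT}$ be the set of all $C^1$ maps $\Phi\colon\partial\mathsf B\to\mathbb R^2$ such that $\frac{d}{d\theta}\Phi(\gamma(\theta))=\lambda_\Phi(\theta)\gamma'(\theta)$ for some $\lambda_\Phi\in C^1(\mathbb R/L\mathbb Z)$. Let $\Omega\subset\mathbb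 R^2$ be a bounded open set and let $m\colon\Omega\to\mathbb R^2$ be measurable with $\|m\|=1$ a.e. in $\Omega$ and $\nabla\cdot m=0$ in $\mathcal D'(\Omega)$. Suppose that, for every open set $\Omega'\subset\subset\Omega$, $$\sup_{0<|h|<\mathrm{dist}(\Omega',\partial\Omega)}\frac1{|h|}\int_{\Omega'}\Pi\big(m(x+h),m(x)\big)\,dx<\infty .$$ Then, for every $\Phi\in\mathrm{ENT}$, the distribution $\nabla\cdot\Phi(m)$ is a (signed) locally finite Radon measure on $\Omega$. -/

import Mathlib

open MeasureTheory TopologicalSpace Set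
open scoped Distributions ENNReal

/-! The plane `ℝ²` is identified with `ℂ`, viewed as a real inner product space with its Lebesgue
measure; multiplication by `i` is the counterclockwise rotation by a right angle. -/

/-- `γ` is a counterclockwise arc-length parametrization of the unit circle `∂B = {N = 1}` of the
norm `N`, and `L` is the length of `∂B`. Two such parametrizations differ by a translation. -/
structure IsArcLengthParam (N : Seminorm ℝ ℂ) (L : ℝ) (γ : ℝ → ℂ) : Prop where
  length_pos : 0 < L
  contDiff : ContDiff ℝ 1 γ
  periodic : Function.Periodic γ L
  injOn : InjOn γ (Ico 0 L)
  range_eq : range γ = {z : ℂ | N z = 1}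
  unit_speed : ∀ θ, ‖deriv γ θ‖ = 1
  /-- `γ(θ)` and `γ'(θ)` form a positively oriented basis of the plane. -/
  counterclockwise : ∀ θ, 0 < (starRingEnd ℂ (γ θ) * deriv γ θ).im

/-- `α` is a continuous determination of the angle of the unit tangent: `γ' = e^{iα}`. -/
structure IsTangentAngle (γ : ℝ → ℂ) (α : ℝ → ℝ) : Prop where
  continuous : Continuous α
  deriv_eq : ∀ θ, deriv γ θ = Complex.exp ((α θ : ℂ) * Complex.I)

/-- The pairing `⟨∇ · F, ζ⟩ = - ∫_Ω F · ∇ζ` of the distributional divergence of a vector field `F`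
on `Ω` with a test function `ζ`; here `F(x) · ∇ζ(x) = Dζ(x)[F(x)]`. -/
noncomputable def divPairing (Ω : Opens ℂ) (F : ℂ → ℂ) (ζ : 𝓓(Ω, ℝ)) : ℝ :=
  -∫ x in (Ω : Set ℂ), fderiv ℝ ζ x (F x)

/-- `m` is a (measurable) weak solution on `Ω` of the generalized eikonal equation
`N(m) = 1` a.e., `∇ · m = 0` in `𝓓'(Ω)`. Only the values of `m` on `Ω` matter. -/
structure IsEikonalSolution (N : Seminorm ℝ ℂ) (Ω : Opens ℂ) (m : ℂ → ℂ) : Prop where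
  aemeasurable : AEMeasurable m (volume.restrict (Ω : Set ℂ))
  norm_eq_one : ∀ᵐ x ∂(volume.restrict (Ω : Set ℂ)), N (m x) = 1
  div_eq_zero : ∀ ζ : 𝓓(Ω, ℝ), divPairing Ω m ζ = 0

/-- `Φ` (of which only the values on `∂B` matter) belongs to the class `ENT` of entropies:
it is `C¹` on the curve `∂B`, and `d/dθ Φ(γ(θ)) = λ(θ) γ'(θ)` for some `C¹`, `L`-periodic `λ`. -/
def IsEntropy (L : ℝ) (γ : ℝ → ℂ) (Φ : ℂ → ℂ) : Prop :=
  ContDiff ℝ 1 (fun θ => Φ (γ θ)) ∧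
    ∃ lam : ℝ → ℝ, ContDiff ℝ 1 lam ∧ Function.Periodic lam L ∧
      ∀ θ, deriv (fun t => Φ (γ t)) θ = (lam θ : ℂ) * deriv γ θ

/-- The distribution `∇ · F` on `Ω` is a (signed) locally finite Radon measure on `Ω`, that is, a
difference of two nonnegative Borel measures which are finite on the compact subsets of `Ω`. -/
def DivIsLocallyFiniteMeasure (Ω : Opens ℂ) (F : ℂ → ℂ) : Prop :=
  ∃ μ ν : Measure ℂ,
    (∀ K : Set ℂ, IsCompact K → K ⊆ Ω → μ K < ∞ ∧ ν K < ∞) ∧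
    ∀ ζ : 𝓓(Ω, ℝ),
      divPairing Ω F ζ = (∫ x in (Ω : Set ℂ), ζ x ∂μ) - ∫ x in (Ω : Set ℂ), ζ x ∂ν

/-- The anisotropic "metric" `Π` on `∂B × ∂B`,
`Π(γ(θ₁), γ(θ₂)) = ∫_{θ₁}^{θ₂} ∫_{θ₁}^{θ₂} |α(t) - α(s)| dt ds` for `|θ₁ - θ₂| ≤ L / 2`.
The integral is the same for all admissible pairs `(θ₁, θ₂)` of parameters of `(z, w)`: they differ
by a common period, except when `w = -z`, where `|θ₁ - θ₂| = L / 2` and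
`α(θ + L / 2) = α(θ) + π` gives the same value on either side. The infimum is thus the
infimum of a constant (and it is `∞` off `∂B × ∂B`, where `Π` is not used). -/
noncomputable def anisoMetric (L : ℝ) (γ : ℝ → ℂ) (α : ℝ → ℝ) (z w : ℂ) : ℝ≥0∞ :=
  ⨅ (θ₁ : ℝ) (θ₂ : ℝ) (_ : γ θ₁ = z) (_ : γ θ₂ = w) (_ : |θ₁ - θ₂| ≤ L / 2),
    ENNReal.ofReal (∫ s in θ₁..θ₂, ∫ t in θ₁..θ₂, |α t - α s|)

/-- The distance `dist(A, ∂Ω)` of a set `A` to the boundary of `Ω`. -/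
noncomputable def distToBoundary (Ω A : Set ℂ) : ℝ≥0∞ :=
  ⨅ x ∈ A, Metric.infEDist x (frontier Ω)

/-- The regularity estimate
`sup_{0 < |h| < dist(Ω', ∂Ω)} |h|⁻¹ ∫_{Ω'} Π(m(x + h), m(x)) dx < ∞`
for all open sets `Ω' ⊂⊂ Ω` (i.e. the closure of `Ω'` is a compact subset of `Ω`). -/
def RegularityEstimate (Ω : Opens ℂ) (L : ℝ) (γ : ℝ → ℂ) (α : ℝ → ℝ) (m : ℂ → ℂ) : Prop :=
  ∀ Ω' : Opens ℂ, IsCompact (closure (Ω' : Set ℂ)) → closure (Ω' : Set ℂ) ⊆ Ω →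
    (⨆ (h : ℂ) (_ : h ≠ 0) (_ : ‖h‖ₑ < distToBoundary Ω Ω'),
      ‖h‖ₑ⁻¹ * ∫⁻ x in (Ω' : Set ℂ), anisoMetric L γ α (m (x + h)) (m x)) < ∞

/-!
The proof is a commutator argument for an extension of `Φ` that is adapted to the entropy condition.

*Extension.* Extend `Φ` to the plane by its first order expansion `F(z) = Φ(γ) + λ (z - γ)` at the
radial projection `γ = z / N(z)` of `z`. Since `dΦ = λ dγ` along `∂B`, the derivatives of `Φ` and `λ`
combine to `DF = λ Id + O(1 - N)`, where only `λ'` enters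
(`IsArcLengthParam.exists_entropy_extension`). Let `m_ρ` be the mollification of `m` at scale `ρ`. As
`∇ · m_ρ = 0`, one gets `|∇ · F(m_ρ)| ≤ C (1 - N(m_ρ)) |∇m_ρ|`. Here `1 - N(m_ρ)` is at most an
average over a ball of the depth of `m` below a supporting line of the unit ball, and `ρ |∇m_ρ|` is at
most an average of `|m - c|`, for any constant `c`.

*Anisotropic variance estimate.* It remains to bound the product of these averages by the average of
`Π(m(x - p), m(x - q))` over `p` and `q` in the ball. For this choose `c` in the direction of the
barycenter of `m`, and use coordinates `w = (1 - v) c + u τ` with `τ` tangent to `∂B` at `c`. If `c`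
lies on the arc from `z` to `w`, then `Π(z, w)` dominates the area of the triangle `z c w`, because
`∫∫ |α(t) - α(s)| ≥ |∫∫ γ'(t) ∧ γ'(s)|`; up to a factor this area is `|u(z)| v(w) + |u(w)| v(z)`.
The mean of `u` vanishes, so integration over all pairs on different sides of `c` yields precisely the
mean of `v` times the mean of `|u|` (`IsArcLengthParam.exists_depth_mul_oscillation_le`). Pairs of
points joined by an arc through `-c` are rare or far apart, and strict convexity bounds `Π` from below
on distant pairs by compactness (`IsArcLengthParam.exists_arcEnergy_lower`).

*Conclusion.* Integrating in `x` and translating, the regularity estimate bounds `∇ · F(m_ρ)` in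
`L¹(K)` for every compact `K ⊆ Ω`, uniformly in `ρ`
(`IsArcLengthParam.exists_lintegral_divergence_bound`). Since `F(m_ρ) → F(m) = Φ(m)` almost
everywhere, `∇ · Φ(m)` is a limit of functions bounded in `L¹` locally, hence a difference of two
locally finite measures (`exists_measures_of_bounded`).
-/

/-! ### The unit circle of the norm and its supporting lines -/

/-- The oriented area `a ∧ b` of the parallelogram spanned by `a, b ∈ ℂ ≃ ℝ²`. -/
noncomputable def wedge (a b : ℂ) : ℝ := (starRingEnd ℂ a * b).im

lemma wedge_eq (a b : ℂ) : wedge a b = a.re * b.im - a.im * b.re := by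
  simp [wedge]; ring

lemma abs_wedge_le (a b : ℂ) : |wedge a b| ≤ ‖a‖ * ‖b‖ := by
  refine (Complex.abs_im_le_norm _).trans (by simp)

lemma continuous_wedge : Continuous fun p : ℂ × ℂ => wedge p.1 p.2 := by
  simp only [wedge_eq]; fun_prop

lemma wedge_swap (a b : ℂ) : wedge b a = -wedge a b := by
  simp only [wedge_eq]; ring

lemma wedge_sub_left (a b c : ℂ) : wedge (a - b) c = wedge a c - wedge b c := by
  simp only [wedge_eq, Complex.sub_re, Complex.sub_im]; ring

lemma wedge_smul_left (r : ℝ) (a b : ℂ) : wedge (r • a) b = r * wedge a b := by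
  simp only [wedge_eq, Complex.real_smul, Complex.mul_re, Complex.mul_im, Complex.ofReal_re,
    Complex.ofReal_im]; ring

lemma HasDerivAt.wedge_const {f : ℝ → ℂ} {f' : ℂ} {t : ℝ} (hf : HasDerivAt f f' t) (q : ℂ) :
    HasDerivAt (fun t => wedge (f t) q) (wedge f' q) t := by
  have h : HasDerivAt (fun t => starRingEnd ℂ (f t)) (starRingEnd ℂ f') t := hf.star
  exact Complex.imCLM.hasFDerivAt.comp_hasDerivAt t (h.mul_const q)

/-- In the basis `(c, τ)`, the coordinates of `w` are quotients of wedge products. -/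
lemma wedge_decomp {c τ : ℂ} (h : wedge c τ ≠ 0) (w : ℂ) :
    w = (wedge w τ / wedge c τ) • c + (wedge c w / wedge c τ) • τ := by
  have key : wedge c τ • w = wedge w τ • c + wedge c w • τ := by
    apply Complex.ext <;>
    simp only [wedge_eq, Complex.real_smul, Complex.mul_re, Complex.mul_im, Complex.ofReal_re,
      Complex.ofReal_im, Complex.add_re, Complex.add_im] <;> ring
  rw [div_eq_inv_mul, div_eq_inv_mul, mul_smul, mul_smul, ← smul_add, ← key, smul_smul,
    inv_mul_cancel₀ h, one_smul]

lemma Seminorm.le_const_mul_norm (N : Seminorm ℝ ℂ) :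
    ∃ C > 0, ∀ z, N z ≤ C * ‖z‖ := by
  refine ⟨N 1 + N Complex.I + 1, by positivity, fun z => ?_⟩
  have hz : z = z.re • (1 : ℂ) + z.im • Complex.I := by
    simp [Complex.re_add_im]
  calc N z = N (z.re • (1 : ℂ) + z.im • Complex.I) := by rw [← hz]
    _ ≤ N (z.re • (1 : ℂ)) + N (z.im • Complex.I) := map_add_le_add _ _ _
    _ = |z.re| * N 1 + |z.im| * N Complex.I := by
        rw [map_smul_eq_mul, map_smul_eq_mul, Real.norm_eq_abs, Real.norm_eq_abs]
    _ ≤ ‖z‖ * N 1 + ‖z‖ * N Complex.I := by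
        gcongr
        · exact Complex.abs_re_le_norm z
        · exact Complex.abs_im_le_norm z
    _ ≤ (N 1 + N Complex.I + 1) * ‖z‖ := by nlinarith [norm_nonneg z]

lemma Function.Periodic.exists_pos_le {f : ℝ → ℝ} {L : ℝ} (hL : 0 < L)
    (hf : Function.Periodic f L) (hc : Continuous f) (hpos : ∀ t, 0 < f t) :
    ∃ κ > 0, ∀ t, κ ≤ f t := by
  obtain ⟨t₀, -, h⟩ := (isCompact_Icc (a := (0 : ℝ)) (b := L)).exists_isMinOn
    ⟨0, by simp [hL.le]⟩ hc.continuousOn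
  refine ⟨f t₀, hpos _, fun t => ?_⟩
  obtain ⟨y, hy, e⟩ := hf.exists_mem_Ico₀ hL t
  rw [e]
  exact h (Ico_subset_Icc_self hy)

namespace IsArcLengthParam

variable {N : Seminorm ℝ ℂ} {L : ℝ} {γ : ℝ → ℂ}

lemma norm_eq_one (hγ : IsArcLengthParam N L γ) (θ : ℝ) : N (γ θ) = 1 := by
  have : γ θ ∈ range γ := ⟨θ, rfl⟩
  rw [hγ.range_eq] at this
  exact this

lemma exists_param (hγ : IsArcLengthParam N L γ) {w : ℂ} (hw : N w = 1) :
    ∃ θ ∈ Ico 0 L, γ θ = w := by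
  have : w ∈ range γ := by rw [hγ.range_eq]; exact hw
  obtain ⟨t, rfl⟩ := this
  obtain ⟨y, hy, e⟩ := hγ.periodic.exists_mem_Ico₀ hγ.length_pos t
  exact ⟨y, hy, e.symm⟩

lemma hasDerivAt (hγ : IsArcLengthParam N L γ) (θ : ℝ) : HasDerivAt γ (deriv γ θ) θ :=
  (hγ.contDiff.differentiable one_ne_zero θ).hasDerivAt

lemma continuous_deriv (hγ : IsArcLengthParam N L γ) : Continuous (deriv γ) :=
  hγ.contDiff.continuous_deriv le_rfl

lemma periodic_deriv (hγ : IsArcLengthParam N L γ) : Function.Periodic (deriv γ) L := by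
  intro t
  rw [← deriv_comp_add_const]
  congr 1
  funext s
  exact hγ.periodic s

lemma wedge_pos (hγ : IsArcLengthParam N L γ) (θ : ℝ) : 0 < wedge (γ θ) (deriv γ θ) :=
  hγ.counterclockwise θ

lemma exists_wedge_lower (hγ : IsArcLengthParam N L γ) :
    ∃ κ > 0, ∀ θ, κ ≤ wedge (γ θ) (deriv γ θ) := by
  refine Function.Periodic.exists_pos_le hγ.length_pos (fun t => ?_) ?_ hγ.wedge_pos
  · simp only [hγ.periodic t, hγ.periodic_deriv t]
  · exact continuous_wedge.comp (hγ.contDiff.continuous.prodMk hγ.continuous_deriv)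

lemma exists_norm_le (hγ : IsArcLengthParam N L γ) :
    ∃ R > 0, ∀ w, N w = 1 → ‖w‖ ≤ R := by
  obtain ⟨C, hC⟩ := (isCompact_Icc (a := (0 : ℝ)) (b := L)).exists_bound_of_continuousOn
    hγ.contDiff.continuous.continuousOn
  refine ⟨max C 1, by positivity, fun w hw => ?_⟩
  obtain ⟨t, ht, rfl⟩ := hγ.exists_param hw
  exact (hC t (Ico_subset_Icc_self ht)).trans (le_max_left _ _)

lemma eq_add_int_mul (hγ : IsArcLengthParam N L γ) {s t : ℝ} (h : γ s = γ t) :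
    ∃ n : ℤ, t = s + n * L := by
  have hL := hγ.length_pos
  obtain ⟨n, hn, -⟩ := existsUnique_add_zsmul_mem_Ico hL s 0
  obtain ⟨k, hk, -⟩ := existsUnique_add_zsmul_mem_Ico hL t 0
  simp only [zsmul_eq_mul, zero_add] at hn hk
  have h' := hγ.injOn hn hk
    (by rw [hγ.periodic.int_mul n s, hγ.periodic.int_mul k t, h])
  refine ⟨n - k, ?_⟩
  push_cast
  linarith

/-- The line tangent to `∂B` at `γ θ` supports the unit ball. -/
lemma wedge_sub_nonneg (hγ : IsArcLengthParam N L γ) (θ : ℝ) {w : ℂ} (hw : N w ≤ 1) :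
    0 ≤ wedge (γ θ - w) (deriv γ θ) := by
  by_contra! hneg
  obtain ⟨C, hC, hN⟩ := N.le_const_mul_norm
  have hk := hγ.wedge_pos θ
  set c := γ θ
  set τ := deriv γ θ
  rw [wedge_sub_left] at hneg
  -- `w'` is the intersection of the tangent line with the segment from `0` to `w`
  set q := wedge w τ / wedge c τ with hq
  have hq1 : 1 < q := by rw [hq, one_lt_div hk]; linarith
  set w' := q⁻¹ • w
  have hw' : N w' < 1 := by
    rw [map_smul_eq_mul, Real.norm_eq_abs, abs_of_pos (by positivity)]
    calc q⁻¹ * N w ≤ q⁻¹ * 1 := by gcongr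
      _ < 1 := by rw [mul_one]; exact inv_lt_one_of_one_lt₀ hq1
  obtain ⟨u, hu⟩ : ∃ u : ℝ, w' = c + u • τ := by
    refine ⟨wedge c w' / wedge c τ, ?_⟩
    have h1 : wedge w' τ / wedge c τ = 1 := by
      rw [wedge_smul_left, mul_div_assoc, ← hq, inv_mul_cancel₀ (by positivity)]
    conv_lhs => rw [wedge_decomp hk.ne' w', h1, one_smul]
  set η := 1 - N w' with hη
  have hη0 : 0 < η := by linarith
  set e := η / (2 * C * (|u| + 1)) with he
  have he0 : 0 < e := by positivity
  have ho := (hasDerivAt_iff_isLittleO.1 (hγ.hasDerivAt θ)).def he0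
  rw [Metric.eventually_nhds_iff] at ho
  obtain ⟨d, hd, ho⟩ := ho
  set r := min 1 (d / (2 * (|u| + 1)))
  have hr0 : 0 < r := by positivity
  have hr1 : r ≤ 1 := min_le_left _ _
  have hrd : |r * u| < d := by
    rw [abs_mul, abs_of_pos hr0]
    calc r * |u| ≤ d / (2 * (|u| + 1)) * |u| := by gcongr; exact min_le_right _ _
      _ < d := by rw [div_mul_eq_mul_div, div_lt_iff₀ (by positivity)]; nlinarith [abs_nonneg u]
  have h1 := ho (y := θ + r * u) (by rwa [Real.dist_eq, add_sub_cancel_left])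
  rw [add_sub_cancel_left, Real.norm_eq_abs, abs_mul, abs_of_pos hr0] at h1
  set p := γ (θ + r * u) - c - (r * u) • τ
  have h2 : γ (θ + r * u) = ((1 - r) • c + r • w') + p := by
    rw [hu]
    simp only [p, smul_add, smul_smul, sub_smul, one_smul]
    abel
  have h3 : (1 : ℝ) ≤ (1 - r) * 1 + r * N w' + C * (e * (r * |u|)) := by
    calc (1 : ℝ) = N (γ (θ + r * u)) := (hγ.norm_eq_one _).symm
      _ ≤ N ((1 - r) • c) + N (r • w') + N p := by
          rw [h2]
          exact (map_add_le_add _ _ _).trans (by gcongr; exact map_add_le_add _ _ _)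
      _ ≤ _ := by
          rw [map_smul_eq_mul, map_smul_eq_mul, Real.norm_eq_abs, Real.norm_eq_abs,
            abs_of_pos hr0, abs_of_nonneg (by linarith : 0 ≤ 1 - r), hγ.norm_eq_one θ]
          gcongr
          exact (hN p).trans (by gcongr)
  have h4 : C * (e * (r * |u|)) ≤ r * η / 2 := by
    rw [he]
    calc C * (η / (2 * C * (|u| + 1)) * (r * |u|)) = r * η / 2 * (|u| / (|u| + 1)) := by
          field_simp
      _ ≤ r * η / 2 * 1 := by
          gcongr
          rw [div_le_one (by positivity)]; linarith
      _ = _ := mul_one _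
  have : r * η ≤ r * η / 2 := by rw [hη] at h4 ⊢; nlinarith
  nlinarith [mul_pos hr0 hη0]

end IsArcLengthParam

/-! ### The energy of an arc -/

/-- The chordal version `∫∫ |γ'(t) - γ'(s)| dt ds` of the integral defining `Π`. Unlike the
latter it is visibly invariant under translations by periods. -/
noncomputable def arcEnergy (γ : ℝ → ℂ) (θ₁ θ₂ : ℝ) : ℝ :=
  ∫ s in θ₁..θ₂, ∫ t in θ₁..θ₂, ‖deriv γ t - deriv γ s‖

lemma arcEnergy_symm (γ : ℝ → ℂ) (θ₁ θ₂ : ℝ) : arcEnergy γ θ₂ θ₁ = arcEnergy γ θ₁ θ₂ := by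
  unfold arcEnergy
  rw [intervalIntegral.integral_symm, ← intervalIntegral.integral_neg]
  congr 1; funext s
  rw [intervalIntegral.integral_symm, neg_neg]

lemma arcEnergy_nonneg (γ : ℝ → ℂ) (θ₁ θ₂ : ℝ) : 0 ≤ arcEnergy γ θ₁ θ₂ := by
  wlog h : θ₁ ≤ θ₂ generalizing θ₁ θ₂
  · rw [arcEnergy_symm]; exact this _ _ (le_of_not_ge h)
  exact intervalIntegral.integral_nonneg h fun s _ =>
    intervalIntegral.integral_nonneg h fun t _ => norm_nonneg _

lemma continuous_integral_of_continuous {φ : ℝ → ℝ → ℝ}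
    (hφ : Continuous (Function.uncurry φ)) (a b : ℝ) :
    Continuous fun s => ∫ t in a..b, φ s t :=
  intervalIntegral.continuous_parametric_intervalIntegral_of_continuous' hφ a b

namespace IsArcLengthParam

variable {N : Seminorm ℝ ℂ} {L : ℝ} {γ : ℝ → ℂ}

lemma continuous_norm_deriv_sub (hγ : IsArcLengthParam N L γ) :
    Continuous (Function.uncurry fun s t => ‖deriv γ t - deriv γ s‖) := by
  have := hγ.continuous_deriv
  unfold Function.uncurry
  fun_prop

lemma continuous_arcEnergy (hγ : IsArcLengthParam N L γ) :
    Continuous fun p : ℝ × ℝ => arcEnergy γ p.1 p.2 := by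
  have h0 := hγ.continuous_norm_deriv_sub
  have hi : ∀ s a b, IntervalIntegrable (fun t => ‖deriv γ t - deriv γ s‖) volume a b :=
    fun s a b => Continuous.intervalIntegrable (h0.comp (continuous_const.prodMk continuous_id)) a b
  have h1 : Continuous fun q : (ℝ × ℝ) × ℝ =>
      ∫ t in q.1.1..q.1.2, ‖deriv γ t - deriv γ q.2‖ := by
    have e : (fun q : (ℝ × ℝ) × ℝ => ∫ t in q.1.1..q.1.2, ‖deriv γ t - deriv γ q.2‖) =
        fun q => (∫ t in (0:ℝ)..q.1.2, ‖deriv γ t - deriv γ q.2‖) -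
          ∫ t in (0:ℝ)..q.1.1, ‖deriv γ t - deriv γ q.2‖ := by
      funext q
      rw [intervalIntegral.integral_interval_sub_left (hi _ _ _) (hi _ _ _)]
    rw [e]
    refine Continuous.sub ?_ ?_ <;>
    · refine intervalIntegral.continuous_parametric_intervalIntegral_of_continuous
        (f := fun (q : (ℝ × ℝ) × ℝ) t => ‖deriv γ t - deriv γ q.2‖) ?_ (by fun_prop)
      have := hγ.continuous_deriv
      unfold Function.uncurry
      fun_prop
  have hj : ∀ (p : ℝ × ℝ) a b, IntervalIntegrable
      (fun s => ∫ t in p.1..p.2, ‖deriv γ t - deriv γ s‖) volume a b :=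
    fun p a b => Continuous.intervalIntegrable
      (h1.comp (continuous_const.prodMk continuous_id)) a b
  have e : (fun p : ℝ × ℝ => arcEnergy γ p.1 p.2) =
      fun p => (∫ s in (0:ℝ)..p.2, ∫ t in p.1..p.2, ‖deriv γ t - deriv γ s‖) -
          ∫ s in (0:ℝ)..p.1, ∫ t in p.1..p.2, ‖deriv γ t - deriv γ s‖ := by
    funext p
    rw [arcEnergy, intervalIntegral.integral_interval_sub_left (hj _ _ _) (hj _ _ _)]
  rw [e]
  refine Continuous.sub ?_ ?_ <;>
  exact intervalIntegral.continuous_parametric_intervalIntegral_of_continuous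
      (f := fun (p : ℝ × ℝ) s => ∫ t in p.1..p.2, ‖deriv γ t - deriv γ s‖) h1 (by fun_prop)

lemma arcEnergy_add_int_mul (hγ : IsArcLengthParam N L γ) (n : ℤ) (θ₁ θ₂ : ℝ) :
    arcEnergy γ (θ₁ + n * L) (θ₂ + n * L) = arcEnergy γ θ₁ θ₂ := by
  unfold arcEnergy
  have h := hγ.periodic_deriv.int_mul n
  rw [← intervalIntegral.integral_comp_add_right]
  congr 1; funext s
  rw [← intervalIntegral.integral_comp_add_right]
  congr 1; funext t
  rw [h t, h s]

lemma arcEnergy_le (hγ : IsArcLengthParam N L γ) {α : ℝ → ℝ} (hα : IsTangentAngle γ α)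
    (θ₁ θ₂ : ℝ) : arcEnergy γ θ₁ θ₂ ≤ ∫ s in θ₁..θ₂, ∫ t in θ₁..θ₂, |α t - α s| := by
  wlog h : θ₁ ≤ θ₂ generalizing θ₁ θ₂
  · rw [arcEnergy_symm]
    refine (this _ _ (le_of_not_ge h)).trans_eq ?_
    rw [intervalIntegral.integral_symm, ← intervalIntegral.integral_neg]
    congr 1; funext s
    rw [intervalIntegral.integral_symm, neg_neg]
  have h0 := hγ.continuous_norm_deriv_sub
  have hα' : Continuous (Function.uncurry fun s t => |α t - α s|) := by
    have := hα.continuous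
    unfold Function.uncurry
    fun_prop
  refine intervalIntegral.integral_mono_on h
    ((continuous_integral_of_continuous h0 _ _).intervalIntegrable _ _)
    ((continuous_integral_of_continuous hα' _ _).intervalIntegrable _ _) fun s _ => ?_
  refine intervalIntegral.integral_mono_on h
    (Continuous.intervalIntegrable (h0.comp (continuous_const.prodMk continuous_id)) _ _)
    (Continuous.intervalIntegrable (hα'.comp (continuous_const.prodMk continuous_id)) _ _)
    fun t _ => ?_
  rw [hα.deriv_eq, hα.deriv_eq]
  have e : Complex.exp (α t * Complex.I) - Complex.exp (α s * Complex.I)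
      = Complex.exp (α s * Complex.I) * (Complex.exp (Complex.I * ((α t - α s : ℝ) : ℂ)) - 1) := by
    rw [mul_sub, ← Complex.exp_add, mul_one]
    congr 2
    push_cast; ring
  rw [e, norm_mul, Complex.norm_exp_ofReal_mul_I, one_mul]
  exact Real.norm_exp_I_mul_ofReal_sub_one_le

/-- The parallelogram spanned by two chords that start at a common point of an arc is controlled
by the energy of the arc. -/
lemma abs_wedge_chords_le (hγ : IsArcLengthParam N L γ) {θ₁ θ₂ s : ℝ} (hs : s ∈ uIcc θ₁ θ₂) :
    |wedge (γ θ₁ - γ s) (γ θ₂ - γ s)| ≤ arcEnergy γ θ₁ θ₂ := by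
  wlog h : θ₁ ≤ θ₂ generalizing θ₁ θ₂
  · rw [arcEnergy_symm, wedge_swap, abs_neg]
    exact this (by rwa [uIcc_comm]) (le_of_not_ge h)
  rw [uIcc_of_le h] at hs
  have hc := hγ.continuous_deriv
  have h0 := hγ.continuous_norm_deriv_sub
  have hw : ∀ q, Continuous fun t => wedge (deriv γ t) q := fun q =>
    continuous_wedge.comp (hc.prodMk continuous_const)
  set q := γ θ₂ - γ s
  have e1 : wedge (γ θ₁ - γ s) q = -∫ t in θ₁..s, wedge (deriv γ t) q := by
    rw [intervalIntegral.integral_eq_sub_of_hasDerivAt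
      (fun t _ => (hγ.hasDerivAt t).wedge_const q) ((hw q).intervalIntegrable _ _),
      wedge_sub_left]
    ring
  have hI := continuous_integral_of_continuous h0 θ₁ θ₂
  have e2 : ∀ t, |wedge (deriv γ t) q| ≤ ∫ t' in θ₁..θ₂, ‖deriv γ t' - deriv γ t‖ := by
    intro t
    have e3 : wedge q (deriv γ t) = ∫ t' in s..θ₂, wedge (deriv γ t') (deriv γ t) := by
      rw [intervalIntegral.integral_eq_sub_of_hasDerivAt
        (fun t' _ => (hγ.hasDerivAt t').wedge_const _) ((hw _).intervalIntegrable _ _),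
        wedge_sub_left]
    have hc' : Continuous fun t' => ‖deriv γ t' - deriv γ t‖ := by fun_prop
    rw [wedge_swap, abs_neg, e3]
    refine (intervalIntegral.abs_integral_le_integral_abs hs.2).trans ?_
    calc _ ≤ ∫ t' in s..θ₂, ‖deriv γ t' - deriv γ t‖ := by
          refine intervalIntegral.integral_mono_on hs.2
            ((hw _).abs.intervalIntegrable _ _) (hc'.intervalIntegrable _ _) fun t' _ => ?_
          have e4 : wedge (deriv γ t') (deriv γ t)
              = wedge (deriv γ t' - deriv γ t) (deriv γ t) := by
            simp only [wedge_eq, Complex.sub_re, Complex.sub_im]; ring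
          rw [e4]
          refine (abs_wedge_le _ _).trans ?_
          rw [hγ.unit_speed, mul_one]
      _ ≤ _ := by
          refine intervalIntegral.integral_mono_interval hs.1 hs.2 le_rfl ?_
            (hc'.intervalIntegrable _ _)
          exact Filter.Eventually.of_forall fun _ => norm_nonneg _
  rw [e1, abs_neg]
  refine (intervalIntegral.abs_integral_le_integral_abs hs.1).trans ?_
  calc _ ≤ ∫ t in θ₁..s, ∫ t' in θ₁..θ₂, ‖deriv γ t' - deriv γ t‖ :=
        intervalIntegral.integral_mono_on hs.1 ((hw _).abs.intervalIntegrable _ _)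
          (hI.intervalIntegrable _ _) fun t _ => e2 t
    _ ≤ _ := by
        refine intervalIntegral.integral_mono_interval le_rfl hs.1 hs.2 ?_
          (hI.intervalIntegrable _ _)
        exact Filter.Eventually.of_forall fun _ =>
          intervalIntegral.integral_nonneg h fun _ _ => norm_nonneg _

/-- Strict convexity of the unit ball means that `∂B` contains no segment, so every nontrivial arc
has positive energy. -/
lemma arcEnergy_pos (hγ : IsArcLengthParam N L γ) (hN : StrictConvex ℝ {z : ℂ | N z ≤ 1})
    {θ₁ θ₂ : ℝ} (h : θ₁ ≠ θ₂) : 0 < arcEnergy γ θ₁ θ₂ := by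
  wlog hlt : θ₁ < θ₂ generalizing θ₁ θ₂
  · rw [arcEnergy_symm]; exact this h.symm (lt_of_le_of_ne (le_of_not_gt hlt) h.symm)
  have h0 := hγ.continuous_norm_deriv_sub
  have hI := continuous_integral_of_continuous h0 θ₁ θ₂
  by_contra hneg
  -- otherwise `γ'` is constant on the arc
  have hcst : ∀ t ∈ Icc θ₁ θ₂, deriv γ t = deriv γ θ₁ := by
    intro t ht
    by_contra hne
    apply hneg
    refine intervalIntegral.integral_pos hlt hI.continuousOn
      (fun s _ => intervalIntegral.integral_nonneg hlt.le fun _ _ => norm_nonneg _)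
      ⟨θ₁, left_mem_Icc.2 hlt.le, ?_⟩
    refine intervalIntegral.integral_pos hlt
      (h0.comp (continuous_const.prodMk continuous_id)).continuousOn
      (fun s _ => norm_nonneg _) ⟨t, ht, norm_pos_iff.2 (sub_ne_zero.2 hne)⟩
  have haff : ∀ t ∈ Icc θ₁ θ₂, γ t = γ θ₁ + (t - θ₁) • deriv γ θ₁ := by
    intro t ht
    have e := intervalIntegral.integral_eq_sub_of_hasDerivAt (a := θ₁) (b := t)
      (fun t _ => hγ.hasDerivAt t) (hγ.continuous_deriv.intervalIntegrable _ _)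
    rw [intervalIntegral.integral_congr (g := fun _ => deriv γ θ₁)
      (fun s hs => hcst s (by rw [uIcc_of_le ht.1] at hs; exact ⟨hs.1, hs.2.trans ht.2⟩)),
      intervalIntegral.integral_const] at e
    rw [e]; ring
  set c := (θ₁ + θ₂) / 2 with hc
  have hmid : γ c = (1 / 2 : ℝ) • γ θ₁ + (1 / 2 : ℝ) • γ θ₂ := by
    rw [haff c ⟨by linarith, by linarith⟩, haff θ₂ ⟨hlt.le, le_rfl⟩]
    have e : c - θ₁ = (1 / 2 : ℝ) * (θ₂ - θ₁) := by rw [hc]; ring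
    have e' : γ θ₁ = (1 / 2 : ℝ) • γ θ₁ + (1 / 2 : ℝ) • γ θ₁ := by rw [← add_smul]; norm_num
    rw [e, mul_smul, smul_add]
    nth_rewrite 1 [e']
    abel
  have hne : γ θ₁ ≠ γ θ₂ := by
    rw [haff θ₂ ⟨hlt.le, le_rfl⟩]
    intro e
    have : (θ₂ - θ₁) • deriv γ θ₁ = 0 := by simpa using e.symm
    rcases smul_eq_zero.1 this with h' | h'
    · linarith
    · have := hγ.unit_speed θ₁; rw [h'] at this; simp at this
  have hint : γ c ∈ interior {z : ℂ | N z ≤ 1} := by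
    rw [hmid]
    exact hN (hγ.norm_eq_one θ₁).le (hγ.norm_eq_one θ₂).le hne (by norm_num) (by norm_num)
      (by norm_num)
  have hcont : Filter.Tendsto (fun r : ℝ => r • γ c) (nhdsWithin 1 (Ioi 1)) (nhds (γ c)) := by
    have : Continuous fun r : ℝ => r • γ c := by fun_prop
    simpa using (this.tendsto 1).mono_left nhdsWithin_le_nhds
  have hev := (hcont.eventually (isOpen_interior.mem_nhds hint)).and self_mem_nhdsWithin
  obtain ⟨r, hr, hr1⟩ := hev.exists
  have := interior_subset hr
  simp only [mem_ofPred_eq, map_smul_eq_mul, hγ.norm_eq_one, mul_one, Real.norm_eq_abs] at this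
  exact absurd ((le_abs_self r).trans this) (not_le.2 hr1)

lemma exists_arcEnergy_lower (hγ : IsArcLengthParam N L γ)
    (hN : StrictConvex ℝ {z : ℂ | N z ≤ 1}) {r : ℝ} (hr : 0 < r) :
    ∃ c > 0, ∀ θ₁ ∈ Icc 0 L, ∀ θ₂ ∈ Icc (-L) (2 * L), r ≤ |θ₁ - θ₂| → c ≤ arcEnergy γ θ₁ θ₂ := by
  have hcpt : IsCompact ((Icc 0 L ×ˢ Icc (-L) (2 * L)) ∩ {p : ℝ × ℝ | r ≤ |p.1 - p.2|}) :=
    (isCompact_Icc.prod isCompact_Icc).inter_right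
      (isClosed_le continuous_const (by fun_prop))
  rcases Set.eq_empty_or_nonempty
    ((Icc 0 L ×ˢ Icc (-L) (2 * L)) ∩ {p : ℝ × ℝ | r ≤ |p.1 - p.2|}) with he | hne
  · refine ⟨1, one_pos, fun θ₁ h₁ θ₂ h₂ h => ?_⟩
    have : (θ₁, θ₂) ∈ ((Icc 0 L ×ˢ Icc (-L) (2 * L)) ∩ {p : ℝ × ℝ | r ≤ |p.1 - p.2|}) :=
      ⟨⟨h₁, h₂⟩, h⟩
    rw [he] at this
    exact this.elim
  · obtain ⟨p, hp, hmin⟩ := hcpt.exists_isMinOn hne hγ.continuous_arcEnergy.continuousOn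
    refine ⟨arcEnergy γ p.1 p.2, hγ.arcEnergy_pos hN ?_, fun θ₁ h₁ θ₂ h₂ h =>
      hmin (show (θ₁, θ₂) ∈ _ from ⟨⟨h₁, h₂⟩, h⟩)⟩
    intro e
    have := hp.2
    simp only [mem_ofPred_eq, e, sub_self, abs_zero] at this
    linarith

end IsArcLengthParam

/-! ### Tangential coordinate and depth -/

/-- The tangential coordinate `u` of `w = (1 - v) γ(θ) + u γ'(θ)`. -/
noncomputable def tangentCoord (γ : ℝ → ℂ) (θ : ℝ) (w : ℂ) : ℝ :=
  wedge (γ θ) w / wedge (γ θ) (deriv γ θ)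

/-- The depth `v` of `w = (1 - v) γ(θ) + u γ'(θ)` below the line tangent to `∂B` at `γ(θ)`; the
functional `w ↦ 1 - v` is the one supporting the unit ball at `γ(θ)`. -/
noncomputable def depth (γ : ℝ → ℂ) (θ : ℝ) (w : ℂ) : ℝ :=
  1 - wedge w (deriv γ θ) / wedge (γ θ) (deriv γ θ)

/-- The indicator function of the points of depth greater than `1 / 2`. Near `-γ(θ)` the tangential
coordinate is small although the depth is not, and the inequalities between the two need this
correction. -/
noncomputable def deepIndicator (γ : ℝ → ℂ) (θ : ℝ) (w : ℂ) : ℝ :=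
  if 1 / 2 < depth γ θ w then 1 else 0

lemma deepIndicator_nonneg (γ : ℝ → ℂ) (θ : ℝ) (w : ℂ) : 0 ≤ deepIndicator γ θ w := by
  unfold deepIndicator; split_ifs <;> norm_num

lemma deepIndicator_le_one (γ : ℝ → ℂ) (θ : ℝ) (w : ℂ) : deepIndicator γ θ w ≤ 1 := by
  unfold deepIndicator; split_ifs <;> norm_num

lemma continuous_depth (γ : ℝ → ℂ) (θ : ℝ) : Continuous (depth γ θ) := by
  unfold depth
  exact continuous_const.sub
    ((continuous_wedge.comp (continuous_id.prodMk continuous_const)).div_const _)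

lemma continuous_tangentCoord (γ : ℝ → ℂ) (θ : ℝ) : Continuous (tangentCoord γ θ) := by
  unfold tangentCoord
  exact (continuous_wedge.comp (continuous_const.prodMk continuous_id)).div_const _

lemma measurable_deepIndicator (γ : ℝ → ℂ) (θ : ℝ) : Measurable (deepIndicator γ θ) := by
  unfold deepIndicator
  exact Measurable.ite (measurableSet_lt measurable_const (continuous_depth γ θ).measurable)
    measurable_const measurable_const

namespace IsArcLengthParam

variable {N : Seminorm ℝ ℂ} {L : ℝ} {γ : ℝ → ℂ}

lemma sub_eq (hγ : IsArcLengthParam N L γ) (θ : ℝ) (w : ℂ) :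
    w - γ θ = tangentCoord γ θ w • deriv γ θ - depth γ θ w • γ θ := by
  conv_lhs => rw [wedge_decomp (hγ.wedge_pos θ).ne' w]
  rw [tangentCoord, depth, sub_smul, one_smul]
  abel

lemma depth_nonneg (hγ : IsArcLengthParam N L γ) (θ : ℝ) {w : ℂ} (hw : N w ≤ 1) :
    0 ≤ depth γ θ w := by
  have h := hγ.wedge_sub_nonneg θ hw
  rw [wedge_sub_left] at h
  rw [depth, sub_nonneg, div_le_one (hγ.wedge_pos θ)]
  linarith

lemma depth_neg (w : ℂ) (θ : ℝ) : depth γ θ (-w) = 2 - depth γ θ w := by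
  have : wedge (-w) (deriv γ θ) = -wedge w (deriv γ θ) := by
    simp only [wedge_eq, Complex.neg_re, Complex.neg_im]; ring
  rw [depth, depth, this]
  ring

lemma depth_le_two (hγ : IsArcLengthParam N L γ) (θ : ℝ) {w : ℂ} (hw : N w ≤ 1) :
    depth γ θ w ≤ 2 := by
  have := hγ.depth_nonneg θ (w := -w) (by rwa [map_neg_eq_map])
  rw [depth_neg] at this
  linarith

lemma exists_radial (hγ : IsArcLengthParam N L γ) (hN_def : ∀ z, N z = 0 → z = 0) (z : ℂ) :
    ∃ θ, z = N z • γ θ := by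
  by_cases h0 : N z = 0
  · exact ⟨0, by rw [hN_def z h0]; simp⟩
  · have hpos : 0 < N z := lt_of_le_of_ne (apply_nonneg N z) (Ne.symm h0)
    obtain ⟨θ, -, e⟩ := hγ.exists_param (w := (N z)⁻¹ • z) (by
      rw [map_smul_eq_mul, Real.norm_eq_abs, abs_of_pos (by positivity), inv_mul_cancel₀ h0])
    exact ⟨θ, by rw [e, smul_smul, mul_inv_cancel₀ h0, one_smul]⟩

lemma depth_smul (hγ : IsArcLengthParam N L γ) (r θ : ℝ) : depth γ θ (r • γ θ) = 1 - r := by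
  rw [depth, wedge_smul_left, mul_div_assoc, div_self (hγ.wedge_pos θ).ne', mul_one]

lemma one_sub_depth_le (hγ : IsArcLengthParam N L γ) (θ : ℝ) (w : ℂ) :
    1 - depth γ θ w ≤ N w := by
  rcases eq_or_lt_of_le (apply_nonneg N w) with h0 | hpos
  · -- a vector of norm zero stays in the unit ball under all dilations
    by_contra! hlt
    rw [← h0] at hlt
    have h := hγ.depth_nonneg θ (w := ((2 : ℝ) / (1 - depth γ θ w)) • w)
      (by rw [map_smul_eq_mul, ← h0, mul_zero]; exact zero_le_one)
    rw [depth, wedge_smul_left, mul_div_assoc] at h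
    have e : wedge w (deriv γ θ) / wedge (γ θ) (deriv γ θ) = 1 - depth γ θ w := by
      rw [depth]; ring
    rw [e, div_mul_cancel₀ _ hlt.ne'] at h
    linarith
  · have h := hγ.depth_nonneg θ (w := (N w)⁻¹ • w) (by
      rw [map_smul_eq_mul, Real.norm_eq_abs, abs_of_pos (by positivity),
        inv_mul_cancel₀ hpos.ne'])
    rw [depth, wedge_smul_left, mul_div_assoc] at h
    have e : wedge w (deriv γ θ) / wedge (γ θ) (deriv γ θ) = 1 - depth γ θ w := by
      rw [depth]; ring
    rw [e, sub_nonneg, inv_mul_le_iff₀ hpos, mul_one] at h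
    exact h

lemma norm_sub_le (hγ : IsArcLengthParam N L γ) (θ₁ θ₂ : ℝ) : ‖γ θ₁ - γ θ₂‖ ≤ |θ₁ - θ₂| := by
  have := Convex.norm_image_sub_le_of_norm_deriv_le (f := γ) (C := 1) (s := univ) (x := θ₂)
    (y := θ₁) (fun x _ => hγ.contDiff.differentiable one_ne_zero x)
    (fun x _ => (hγ.unit_speed x).le) convex_univ trivial trivial
  simpa using this

/-- Uniform comparison of the coordinates `(u, v)` at the points of `∂B` with the norms. -/
lemma exists_coord_bounds (hγ : IsArcLengthParam N L γ) :
    ∃ C ≥ 1, ∀ θ,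
      (∀ w, N w = 1 → |tangentCoord γ θ w| ≤ C) ∧
      (∀ w w', |depth γ θ w - depth γ θ w'| ≤ C * ‖w - w'‖) ∧
      (∀ w, N w = 1 → ‖w - γ θ‖ ≤ C * (|tangentCoord γ θ w| + depth γ θ w)) ∧
      (∀ w, N w = 1 → depth γ θ w ≤ C * |tangentCoord γ θ w| + 2 * deepIndicator γ θ w) := by
  obtain ⟨κ, hκ, hκ'⟩ := hγ.exists_wedge_lower
  obtain ⟨R, hR, hR'⟩ := hγ.exists_norm_le
  obtain ⟨A, hA, hA'⟩ := N.le_const_mul_norm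
  refine ⟨1 + R * R / κ + 1 / κ + R + A, by
    have := div_pos (mul_pos hR hR) hκ
    have := div_pos one_pos hκ
    linarith, fun θ => ⟨fun w hw => ?_, fun w w' => ?_, fun w hw => ?_, fun w hw => ?_⟩⟩ <;>
    have h1 := div_pos (mul_pos hR hR) hκ <;> have h2 := div_pos one_pos hκ
  · rw [tangentCoord, abs_div, abs_of_pos (hγ.wedge_pos θ)]
    calc |wedge (γ θ) w| / wedge (γ θ) (deriv γ θ) ≤ R * R / κ := by
          gcongr
          · exact (abs_wedge_le _ _).trans
              (mul_le_mul (hR' _ (hγ.norm_eq_one θ)) (hR' w hw) (norm_nonneg _) hR.le)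
          · exact hκ' θ
      _ ≤ _ := by linarith
  · have e : depth γ θ w - depth γ θ w' =
        -(wedge (w - w') (deriv γ θ) / wedge (γ θ) (deriv γ θ)) := by
      rw [depth, depth, wedge_sub_left]; ring
    rw [e, abs_neg, abs_div, abs_of_pos (hγ.wedge_pos θ)]
    calc |wedge (w - w') (deriv γ θ)| / wedge (γ θ) (deriv γ θ) ≤ ‖w - w'‖ / κ := by
          gcongr
          · refine (abs_wedge_le _ _).trans ?_
            rw [hγ.unit_speed, mul_one]
          · exact hκ' θ
      _ = 1 / κ * ‖w - w'‖ := by ring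
      _ ≤ _ := by gcongr; linarith
  · have hd := hγ.depth_nonneg θ hw.le
    rw [hγ.sub_eq]
    calc _ ≤ |tangentCoord γ θ w| * 1 + depth γ θ w * R := by
          refine (_root_.norm_sub_le _ _).trans ?_
          rw [norm_smul, norm_smul, hγ.unit_speed, Real.norm_eq_abs, Real.norm_eq_abs,
            abs_of_nonneg hd]
          gcongr
          exact hR' _ (hγ.norm_eq_one θ)
      _ ≤ _ := by
          rw [mul_add, mul_comm (depth γ θ w)]
          have := abs_nonneg (tangentCoord γ θ w)
          rw [mul_comm _ (1 : ℝ)]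
          gcongr <;> linarith
  · have hd := hγ.depth_nonneg θ hw.le
    have hd2 := hγ.depth_le_two θ hw.le
    have hu := abs_nonneg (tangentCoord γ θ w)
    unfold deepIndicator
    split_ifs with h
    · have : 0 ≤ (1 + R * R / κ + 1 / κ + R + A) * |tangentCoord γ θ w| := by positivity
      linarith
    · push Not at h
      have e : w = (1 - depth γ θ w) • γ θ + tangentCoord γ θ w • deriv γ θ := by
        have := hγ.sub_eq θ w
        rw [sub_smul, one_smul]
        linear_combination this
      have h3 : (1 : ℝ) ≤ (1 - depth γ θ w) + |tangentCoord γ θ w| * A := by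
        calc (1 : ℝ) = N w := hw.symm
          _ ≤ N ((1 - depth γ θ w) • γ θ) + N (tangentCoord γ θ w • deriv γ θ) := by
              conv_lhs => rw [e]
              exact map_add_le_add _ _ _
          _ ≤ _ := by
              rw [map_smul_eq_mul, map_smul_eq_mul, hγ.norm_eq_one, Real.norm_eq_abs,
                Real.norm_eq_abs, abs_of_nonneg (by linarith : 0 ≤ 1 - depth γ θ w), mul_one]
              gcongr
              have := hA' (deriv γ θ)
              rwa [hγ.unit_speed, mul_one] at this
      have h4 : |tangentCoord γ θ w| * A ≤
          (1 + R * R / κ + 1 / κ + R + A) * |tangentCoord γ θ w| := by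
        rw [mul_comm]; gcongr; linarith
      linarith

/-- If `γ(θ)` separates `γ(θ₁)` from `γ(θ₂)`, the energy of an arc joining these two points controls
the area of the triangle with the vertices `γ(θ₁)`, `γ(θ)`, `γ(θ₂)`, unless the arc runs through
`-γ(θ)` and starts close to it. -/
lemma exists_triangle_le_arcEnergy (hγ : IsArcLengthParam N L γ)
    (hN : StrictConvex ℝ {z : ℂ | N z ≤ 1}) :
    ∃ C > 0, ∀ θ, ∀ θ₁ ∈ Icc 0 L, ∀ θ₂ ∈ Icc (-L) (2 * L),
      tangentCoord γ θ (γ θ₁) ≤ 0 → 0 < tangentCoord γ θ (γ θ₂) →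
      -tangentCoord γ θ (γ θ₁) * depth γ θ (γ θ₂) + tangentCoord γ θ (γ θ₂) * depth γ θ (γ θ₁)
        ≤ C * (arcEnergy γ θ₁ θ₂ + deepIndicator γ θ (γ θ₁)) := by
  obtain ⟨κ, hκ, hκ'⟩ := hγ.exists_wedge_lower
  obtain ⟨B, hB, hB'⟩ := hγ.exists_coord_bounds
  obtain ⟨c, hc, hc'⟩ := hγ.exists_arcEnergy_lower hN (r := 1 / B) (by positivity)
  refine ⟨4 * B + 1 / κ + 4 * B / c, by positivity, fun θ θ₁ h₁ θ₂ h₂ hu₁ hu₂ => ?_⟩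
  obtain ⟨hBu, hBv, -, -⟩ := hB' θ
  have hP := arcEnergy_nonneg γ θ₁ θ₂
  have hχ := deepIndicator_nonneg γ θ (γ θ₁)
  have h1κ : 0 < 1 / κ := by positivity
  have h4c : 0 < 4 * B / c := by positivity
  have hv₁ := hγ.depth_nonneg θ (hγ.norm_eq_one θ₁).le
  have hv₂ := hγ.depth_nonneg θ (hγ.norm_eq_one θ₂).le
  have hv₁' := hγ.depth_le_two θ (hγ.norm_eq_one θ₁).le
  have hv₂' := hγ.depth_le_two θ (hγ.norm_eq_one θ₂).le
  have hb₁ := hBu _ (hγ.norm_eq_one θ₁)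
  have hb₂ := hBu _ (hγ.norm_eq_one θ₂)
  rw [abs_of_nonpos hu₁] at hb₁
  rw [abs_of_pos hu₂] at hb₂
  set u₁ := tangentCoord γ θ (γ θ₁) with hu₁'
  set u₂ := tangentCoord γ θ (γ θ₂) with hu₂'
  set v₁ := depth γ θ (γ θ₁) with hv₁''
  set v₂ := depth γ θ (γ θ₂)
  have hcrude : -u₁ * v₂ + u₂ * v₁ ≤ 4 * B := by nlinarith
  -- the arc meets the line through `0` and `γ θ`
  obtain ⟨s, hs, hs0⟩ : ∃ s ∈ uIcc θ₁ θ₂, tangentCoord γ θ (γ s) = 0 := by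
    have hcont : ContinuousOn (fun t => tangentCoord γ θ (γ t)) (uIcc θ₁ θ₂) :=
      ((continuous_tangentCoord γ θ).comp hγ.contDiff.continuous).continuousOn
    have := intermediate_value_uIcc hcont
    have h0 : (0 : ℝ) ∈ uIcc (tangentCoord γ θ (γ θ₁)) (tangentCoord γ θ (γ θ₂)) := by
      rw [uIcc_of_le (hu₁.trans hu₂.le)]; exact ⟨hu₁, hu₂.le⟩
    obtain ⟨s, hs, e⟩ := this h0
    exact ⟨s, hs, e⟩
  have hline : γ s = (1 - depth γ θ (γ s)) • γ θ := by
    have := hγ.sub_eq θ (γ s)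
    rw [hs0, zero_smul] at this
    rw [sub_smul, one_smul]
    linear_combination this
  have habs : |1 - depth γ θ (γ s)| = 1 := by
    have := hγ.norm_eq_one s
    rw [hline, map_smul_eq_mul, hγ.norm_eq_one, mul_one, Real.norm_eq_abs] at this
    exact this
  rcases (abs_eq zero_le_one).1 habs with h | h
  · -- the arc contains `γ θ`
    rw [h, one_smul] at hline
    have htri := hγ.abs_wedge_chords_le hs
    rw [hline, hγ.sub_eq θ (γ θ₁), hγ.sub_eq θ (γ θ₂)] at htri
    have e : wedge (u₁ • deriv γ θ - v₁ • γ θ) (u₂ • deriv γ θ - v₂ • γ θ) =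
        -((-u₁ * v₂ + u₂ * v₁) * wedge (γ θ) (deriv γ θ)) := by
      simp only [wedge_eq, Complex.real_smul, Complex.mul_re, Complex.mul_im, Complex.ofReal_re,
        Complex.ofReal_im, Complex.sub_re, Complex.sub_im]
      ring
    rw [e, abs_neg] at htri
    have hX : 0 ≤ -u₁ * v₂ + u₂ * v₁ := by nlinarith
    have h3 : (-u₁ * v₂ + u₂ * v₁) * κ ≤ arcEnergy γ θ₁ θ₂ := by
      refine le_trans ?_ ((le_abs_self _).trans htri)
      gcongr
      exact hκ' θ
    calc _ ≤ 1 / κ * arcEnergy γ θ₁ θ₂ := by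
          rw [one_div, ← div_eq_inv_mul, le_div_iff₀ hκ]; exact h3
      _ ≤ _ := by
          gcongr
          · linarith
          · linarith
  · by_cases hdeep : 1 / 2 < v₁
    · have : deepIndicator γ θ (γ θ₁) = 1 := by rw [deepIndicator, if_pos hdeep]
      rw [this]
      calc _ ≤ 4 * B := hcrude
        _ ≤ (4 * B + 1 / κ + 4 * B / c) * 1 := by linarith
        _ ≤ _ := by gcongr; linarith
    · -- the arc runs from a point far away from `-γ θ` to `-γ θ`, so it is long
      push Not at hdeep
      have h2 : depth γ θ (γ s) = 2 := by linarith
      have h3 := hBv (γ s) (γ θ₁)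
      rw [h2, ← hv₁'', abs_of_nonneg (by linarith)] at h3
      have h4 : 1 / B ≤ ‖γ s - γ θ₁‖ := by
        rw [div_le_iff₀ (by positivity), mul_comm]; linarith
      have h5 : |s - θ₁| ≤ |θ₁ - θ₂| := by
        rw [abs_sub_comm θ₁ θ₂]
        exact abs_sub_left_of_mem_uIcc hs
      have h6 := hc' θ₁ h₁ θ₂ h₂ ((h4.trans (hγ.norm_sub_le _ _)).trans h5)
      calc _ ≤ 4 * B := hcrude
        _ = 4 * B / c * c := by field_simp
        _ ≤ _ := by
          gcongr
          · linarith
          · linarith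

/-! ### A Borel minorant of the metric -/

/-- A bounded Borel minorant `g` of the metric `Π` which keeps its two essential lower bounds: `far`
for pairs of distant points, and `triangle` for pairs separated by a third point of `∂B`. Measurability
of `Π` itself is thus not an issue: a lower Lebesgue integral of `Π` bounds the integral of `g`. -/
structure IsPairMinorant (N : Seminorm ℝ ℂ) (L : ℝ) (γ : ℝ → ℂ) (α : ℝ → ℝ) (g : ℂ → ℂ → ℝ) :
    Prop where
  measurable : Measurable (Function.uncurry g)
  nonneg : ∀ z w, 0 ≤ g z w
  bounded : ∃ M, ∀ z w, g z w ≤ M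
  diag : ∀ z, g z z = 0
  le_anisoMetric : ∀ z w, ENNReal.ofReal (g z w) ≤ anisoMetric L γ α z w
  far : ∀ r > 0, ∃ c > 0, ∀ z w, N z = 1 → N w = 1 → r ≤ ‖z - w‖ → c ≤ g z w
  triangle : ∃ C > 0, ∀ θ z w, N z = 1 → N w = 1 →
    tangentCoord γ θ z ≤ 0 → 0 < tangentCoord γ θ w →
    -tangentCoord γ θ z * depth γ θ w + tangentCoord γ θ w * depth γ θ z
      ≤ C * (g z w + deepIndicator γ θ z)

/-- The minorant is the least energy of the arcs that start at the parameter of `z` in `[0, L)` and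
end at one of the three nearest parameters of `w`; no other pairs of parameters enter the definition
of `Π`, up to translation by a common period. -/
lemma exists_isPairMinorant (hγ : IsArcLengthParam N L γ)
    (hN : StrictConvex ℝ {z : ℂ | N z ≤ 1}) {α : ℝ → ℝ} (hα : IsTangentAngle γ α) :
    ∃ g, IsPairMinorant N L γ α g := by
  have hL := hγ.length_pos
  -- a measurable inverse of the parametrization
  obtain ⟨τ, hτm, hτI, hτ⟩ : ∃ τ : ℂ → ℝ, Measurable τ ∧ (∀ z, τ z ∈ Icc 0 L) ∧
      ∀ z, N z = 1 → γ (τ z) = z := by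
    have hemb := ContinuousOn.measurableEmbedding (measurableSet_Ico (a := (0 : ℝ)) (b := L))
      hγ.contDiff.continuous.continuousOn hγ.injOn
    obtain ⟨τ, hτm, hτ⟩ := hemb.exists_measurable_extend measurable_subtype_coe
      (fun _ => ⟨(0 : ℝ)⟩)
    refine ⟨fun z => max 0 (min L (τ z)), by fun_prop, fun z =>
      ⟨le_max_left _ _, max_le hL.le (min_le_left _ _)⟩, fun z hz => ?_⟩
    obtain ⟨θ, hθ, rfl⟩ := hγ.exists_param hz
    have e : τ (γ θ) = θ := congrFun hτ (⟨θ, hθ⟩ : Ico 0 L)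
    simp only [e, min_eq_right hθ.2.le, max_eq_right hθ.1]
  set g : ℂ → ℂ → ℝ := fun z w => min (arcEnergy γ (τ z) (τ w))
    (min (arcEnergy γ (τ z) (τ w + L)) (arcEnergy γ (τ z) (τ w - L))) with hg
  have hg0 : ∀ z w, 0 ≤ g z w := fun z w =>
    le_min (arcEnergy_nonneg _ _ _) (le_min (arcEnergy_nonneg _ _ _) (arcEnergy_nonneg _ _ _))
  -- the value of `g` is the energy of an arc joining the two points
  have hsel : ∀ z w, N w = 1 → ∃ θ₂ ∈ Icc (-L) (2 * L), γ θ₂ = w ∧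
      g z w = arcEnergy γ (τ z) θ₂ := by
    intro z w hw
    obtain ⟨h0, h1⟩ := hτI w
    have e := hτ w hw
    rcases min_choice (arcEnergy γ (τ z) (τ w))
      (min (arcEnergy γ (τ z) (τ w + L)) (arcEnergy γ (τ z) (τ w - L))) with h | h
    · exact ⟨τ w, ⟨by linarith, by linarith⟩, e, h⟩
    · rcases min_choice (arcEnergy γ (τ z) (τ w + L)) (arcEnergy γ (τ z) (τ w - L)) with h' | h'
      · exact ⟨τ w + L, ⟨by linarith, by linarith⟩, by rw [hγ.periodic, e], h.trans h'⟩
      · exact ⟨τ w - L, ⟨by linarith, by linarith⟩, by rw [hγ.periodic.sub_eq, e], h.trans h'⟩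
  refine ⟨g, ?_, hg0, ?_, ?_, ?_, ?_, ?_⟩
  · have hc := hγ.continuous_arcEnergy.measurable
    have h : ∀ f : ℝ → ℝ, Measurable f →
        Measurable fun p : ℂ × ℂ => arcEnergy γ (τ p.1) (f (τ p.2)) := fun f hf =>
      hc.comp ((hτm.comp measurable_fst).prodMk (hf.comp (hτm.comp measurable_snd)))
    exact (h id measurable_id).min ((h (· + L) (by fun_prop)).min (h (· - L) (by fun_prop)))
  · obtain ⟨M, hM⟩ := ((isCompact_Icc (a := (0 : ℝ)) (b := L)).prod
      (isCompact_Icc (a := (0 : ℝ)) (b := L))).exists_bound_of_continuousOn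
      hγ.continuous_arcEnergy.continuousOn
    refine ⟨M, fun z w => (min_le_left _ _).trans ?_⟩
    exact (le_abs_self _).trans (hM (τ z, τ w) ⟨hτI z, hτI w⟩)
  · intro z
    refine le_antisymm ((min_le_left _ _).trans_eq ?_) (hg0 z z)
    rw [arcEnergy, intervalIntegral.integral_same]
  · intro z w
    refine le_iInf fun θ₁ => le_iInf fun θ₂ => le_iInf fun hz => le_iInf fun hw =>
      le_iInf fun hθ => ENNReal.ofReal_le_ofReal ((?_ : g z w ≤ _).trans (hγ.arcEnergy_le hα _ _))
    have hNz : N z = 1 := by rw [← hz]; exact hγ.norm_eq_one _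
    have hNw : N w = 1 := by rw [← hw]; exact hγ.norm_eq_one _
    obtain ⟨a, ha⟩ := hγ.eq_add_int_mul (hz.trans (hτ z hNz).symm)
    obtain ⟨b, hb⟩ := hγ.eq_add_int_mul (hw.trans (hτ w hNw).symm)
    obtain ⟨k, hk⟩ : ∃ k : ℤ, k = a - b := ⟨_, rfl⟩
    have e : arcEnergy γ θ₁ θ₂ = arcEnergy γ (τ z) (τ w + k * L) := by
      rw [← hγ.arcEnergy_add_int_mul a θ₁ θ₂, ha, hb, hk]
      congr 1; push_cast; ring
    have hkL : |(k : ℝ) * L| < 2 * L := by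
      have e' : (k : ℝ) * L = (τ z - τ w) - (θ₁ - θ₂) := by rw [ha, hb, hk]; push_cast; ring
      obtain ⟨h1, h2⟩ := hτI z
      obtain ⟨h3, h4⟩ := hτI w
      rw [e', abs_lt]
      obtain ⟨h5, h6⟩ := abs_le.1 hθ
      constructor <;> linarith
    rw [abs_mul, abs_of_pos hL] at hkL
    have hk2 : |k| < 2 := by
      have := lt_of_mul_lt_mul_right hkL hL.le
      exact_mod_cast this
    obtain ⟨hk3, hk4⟩ := abs_lt.1 hk2
    rw [e]
    have : k = 0 ∨ k = 1 ∨ k = -1 := by omega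
    rcases this with rfl | rfl | rfl
    · rw [Int.cast_zero, zero_mul, add_zero]
      exact min_le_left _ _
    · rw [Int.cast_one, one_mul]
      exact (min_le_right _ _).trans (min_le_left _ _)
    · have : τ w + ((-1 : ℤ) : ℝ) * L = τ w - L := by push_cast; ring
      rw [this]
      exact (min_le_right _ _).trans (min_le_right _ _)
  · intro r hr
    obtain ⟨c, hc, hc'⟩ := hγ.exists_arcEnergy_lower hN hr
    refine ⟨c, hc, fun z w hz hw h => ?_⟩
    obtain ⟨θ₂, hθ₂, e, e'⟩ := hsel z w hw
    rw [e']
    refine hc' _ (hτI z) _ hθ₂ (h.trans ?_)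
    have := hγ.norm_sub_le (τ z) θ₂
    rwa [hτ z hz, e] at this
  · obtain ⟨C, hC, hC'⟩ := hγ.exists_triangle_le_arcEnergy hN
    refine ⟨C, hC, fun θ z w hz hw h1 h2 => ?_⟩
    obtain ⟨θ₂, hθ₂, e, e'⟩ := hsel z w hw
    have h := hC' θ (τ z) (hτI z) θ₂ hθ₂
    rw [hτ z hz, e, ← e'] at h
    exact h h1 h2

end IsArcLengthParam

/-! ### The anisotropic variance estimate -/

lemma wedge_integral_left {X : Type*} [MeasurableSpace X] {ν : Measure X} {f : X → ℂ}
    (hf : Integrable f ν) (b : ℂ) : ∫ x, wedge (f x) b ∂ν = wedge (∫ x, f x ∂ν) b := by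
  have h := (b.im • Complex.reCLM - b.re • Complex.imCLM).integral_comp_comm hf
  simp only [sub_apply, smul_apply, smul_eq_mul,
    Complex.reCLM_apply, Complex.imCLM_apply] at h
  simp only [wedge_eq]
  rw [← sub_eq_zero] at h ⊢
  rw [← h]
  congr 1
  · congr 1; funext x; ring
  · ring

lemma wedge_integral_right {X : Type*} [MeasurableSpace X] {ν : Measure X} {f : X → ℂ}
    (hf : Integrable f ν) (b : ℂ) : ∫ x, wedge b (f x) ∂ν = wedge b (∫ x, f x ∂ν) := by
  simp only [wedge_swap _ b, ← wedge_integral_left hf b, ← integral_neg]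

namespace IsArcLengthParam

variable {N : Seminorm ℝ ℂ} {L : ℝ} {γ : ℝ → ℂ}

/-- The anisotropic variance estimate: for a random point `m` of `∂B`, the distance of the barycenter
to `∂B` times the mean oscillation of `m` is controlled by the mean of `g(m, m')` for an independent
copy `m'`. The point `γ θ` is the radial projection of the barycenter, so the tangential coordinate
has mean zero, and integrating the triangle inequality over the independent pairs which lie on
different sides of `γ θ` produces exactly the product on the left. -/
theorem exists_depth_mul_oscillation_le (hγ : IsArcLengthParam N L γ)
    (hN_def : ∀ z, N z = 0 → z = 0) {α : ℝ → ℝ} {g : ℂ → ℂ → ℝ}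
    (hg : IsPairMinorant N L γ α g) :
    ∃ C > 0, ∀ (ν : Measure ℂ) [IsProbabilityMeasure ν] (m : ℂ → ℂ), Measurable m →
      (∀ x, N (m x) = 1) → ∃ θ,
        (∫ x, depth γ θ (m x) ∂ν) * (∫ x, ‖m x - γ θ‖ ∂ν) ≤
          C * ∫ p, g (m p.1) (m p.2) ∂(ν.prod ν) := by
  obtain ⟨R, hR, hR'⟩ := hγ.exists_norm_le
  obtain ⟨A, hA, hA'⟩ := N.le_const_mul_norm
  obtain ⟨B, hB, hB'⟩ := hγ.exists_coord_bounds
  obtain ⟨c₁, hc₁, hc₁'⟩ := hg.far (1 / (16 * A)) (by positivity)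
  obtain ⟨c₂, hc₂, hc₂'⟩ := hg.far (1 / (4 * B)) (by positivity)
  obtain ⟨T, hT, hT'⟩ := hg.triangle
  obtain ⟨M, hM⟩ := hg.bounded
  set K := A * (2 * R / c₁) with hK
  have hK0 : 0 < K := by positivity
  refine ⟨64 * R * K + 2 * B * (1 + B) * (T * (1 + 2 / c₂)) + 4 * B / c₂, by positivity,
    fun ν _ m hm hm1 => ?_⟩
  have hmR : ∀ x, ‖m x‖ ≤ R := fun x => hR' _ (hm1 x)
  have hmi : Integrable m ν :=
    Integrable.of_bound hm.aestronglyMeasurable R (Filter.Eventually.of_forall hmR)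
  set z := ∫ x, m x ∂ν with hz
  obtain ⟨θ, hθ⟩ := hγ.exists_radial hN_def z
  refine ⟨θ, ?_⟩
  have hk := hγ.wedge_pos θ
  obtain ⟨hBu, hBv, hBn, hBd⟩ := hB' θ
  set D := ∫ p, g (m p.1) (m p.2) ∂(ν.prod ν) with hD
  have hgm : Measurable fun p : ℂ × ℂ => g (m p.1) (m p.2) :=
    hg.measurable.comp ((hm.comp measurable_fst).prodMk (hm.comp measurable_snd))
  have hgi : Integrable (fun p : ℂ × ℂ => g (m p.1) (m p.2)) (ν.prod ν) :=
    Integrable.of_bound hgm.aestronglyMeasurable M (Filter.Eventually.of_forall fun p => by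
      rw [Real.norm_eq_abs, abs_of_nonneg (hg.nonneg _ _)]; exact hM _ _)
  have hD0 : 0 ≤ D := integral_nonneg fun p => hg.nonneg _ _
  set u : ℂ → ℝ := fun x => tangentCoord γ θ (m x) with hu
  set v : ℂ → ℝ := fun x => depth γ θ (m x) with hv
  set χ : ℂ → ℝ := fun x => deepIndicator γ θ (m x) with hχ
  have hum : Measurable u := (continuous_tangentCoord γ θ).measurable.comp hm
  have hvm : Measurable v := (continuous_depth γ θ).measurable.comp hm
  have hχm : Measurable χ := (measurable_deepIndicator γ θ).comp hm
  have hv0 : ∀ x, 0 ≤ v x := fun x => hγ.depth_nonneg θ (hm1 x).le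
  have hv2 : ∀ x, v x ≤ 2 := fun x => hγ.depth_le_two θ (hm1 x).le
  have hχ0 : ∀ x, 0 ≤ χ x := fun x => deepIndicator_nonneg _ _ _
  have hχ1 : ∀ x, χ x ≤ 1 := fun x => deepIndicator_le_one _ _ _
  have huB : ∀ x, |u x| ≤ B := fun x => hBu _ (hm1 x)
  have bdd : ∀ {f : ℂ → ℝ} (b : ℝ), Measurable f → (∀ x, |f x| ≤ b) → Integrable f ν :=
    fun b hf hb => Integrable.of_bound hf.aestronglyMeasurable b (Filter.Eventually.of_forall hb)
  have hui : Integrable u ν := bdd B hum huB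
  have hvi : Integrable v ν := bdd 2 hvm fun x => by rw [abs_of_nonneg (hv0 x)]; exact hv2 x
  have hχi : Integrable χ ν := bdd 1 hχm fun x => by rw [abs_of_nonneg (hχ0 x)]; exact hχ1 x
  have hni : Integrable (fun x => ‖m x - γ θ‖) ν := (hmi.sub (integrable_const _)).norm
  set δ := ∫ x, v x ∂ν with hδ
  have hδN : δ = 1 - N z := by
    have h1 : δ = 1 - wedge z (deriv γ θ) / wedge (γ θ) (deriv γ θ) := by
      rw [hδ, hv]
      simp only [depth]
      rw [integral_sub (integrable_const _), integral_div, wedge_integral_left hmi]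
      · simp [hz]
      · refine (bdd (R / wedge (γ θ) (deriv γ θ)) ?_ fun x => ?_)
        · exact ((continuous_wedge.comp (continuous_id.prodMk continuous_const)).div_const
            _).measurable.comp hm
        · rw [abs_div, abs_of_pos hk]
          gcongr
          refine (abs_wedge_le _ _).trans ?_
          rw [hγ.unit_speed, mul_one]; exact hmR x
    rw [h1, hθ, map_smul_eq_mul, hγ.norm_eq_one, mul_one, Real.norm_eq_abs, abs_of_nonneg
      (apply_nonneg N z), wedge_smul_left, mul_div_assoc, div_self hk.ne', mul_one]
  have hu0 : ∫ x, u x ∂ν = 0 := by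
    have : ∫ x, u x ∂ν = wedge (γ θ) z / wedge (γ θ) (deriv γ θ) := by
      rw [hu]
      simp only [tangentCoord]
      rw [integral_div, wedge_integral_right hmi]
    rw [this, hθ]
    have e : wedge (γ θ) (N z • γ θ) = 0 := by
      rw [wedge_swap, wedge_smul_left, wedge_eq]; ring
    rw [e, zero_div]
  have hδ0 : 0 ≤ δ := integral_nonneg hv0
  have hδ2 : δ ≤ 2 := by
    rw [hδN]; linarith [apply_nonneg N z]
  set p := ∫ x, χ x ∂ν with hp
  have hp0 : 0 ≤ p := integral_nonneg hχ0
  have prodfst : ∀ {f : ℂ → ℝ}, Integrable f ν →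
      Integrable (fun q : ℂ × ℂ => f q.1) (ν.prod ν) := fun hf => hf.comp_fst ν
  have intfst : ∀ f : ℂ → ℝ, ∫ q : ℂ × ℂ, f q.1 ∂(ν.prod ν) = ∫ x, f x ∂ν := fun f => by
    simpa using integral_prod_mul (μ := ν) (ν := ν) f (fun _ => (1 : ℝ))
  have hw0 : 0 ≤ 2 * B * (1 + B) * (T * (1 + 2 / c₂)) := by positivity
  have hw1 : 0 ≤ 4 * B / c₂ := by positivity
  rcases le_or_gt (1 / 8) δ with hcase | hcase
  · -- the oscillation is of order one
    have h1 : ∀ y, δ ≤ ∫ x, A * ‖m y - m x‖ ∂ν := by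
      intro y
      have e : m y - z = ∫ x, (m y - m x) ∂ν := by
        rw [integral_sub (integrable_const _) hmi]; simp [hz]
      have h2 : N (m y) ≤ N (m y - z) + N z := by
        conv_lhs => rw [← sub_add_cancel (m y) z]
        exact map_add_le_add _ _ _
      rw [hδN, integral_const_mul]
      calc 1 - N z ≤ N (m y - z) := by rw [hm1 y] at h2; linarith
        _ ≤ A * ‖m y - z‖ := hA' _
        _ ≤ _ := by
            rw [e]; gcongr; exact norm_integral_le_integral_norm _
    have hyi : Integrable (fun q : ℂ × ℂ => A * ‖m q.1 - m q.2‖) (ν.prod ν) := by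
      refine Integrable.of_bound (Measurable.aestronglyMeasurable (by fun_prop)) (A * (R + R))
        (Filter.Eventually.of_forall fun q => ?_)
      rw [Real.norm_eq_abs, abs_of_nonneg (by positivity)]
      gcongr
      exact (_root_.norm_sub_le _ _).trans (add_le_add (hmR _) (hmR _))
    have h3 : δ ≤ ∫ q : ℂ × ℂ, A * ‖m q.1 - m q.2‖ ∂(ν.prod ν) := by
      rw [integral_prod _ hyi]
      calc δ = ∫ _, δ ∂ν := by simp
        _ ≤ _ := integral_mono (integrable_const _) hyi.integral_prod_left h1
    have h4 : ∫ q : ℂ × ℂ, A * ‖m q.1 - m q.2‖ ∂(ν.prod ν) ≤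
        ∫ q : ℂ × ℂ, (1 / 16 + K * g (m q.1) (m q.2)) ∂(ν.prod ν) := by
      refine integral_mono hyi ((integrable_const _).add (hgi.const_mul K)) fun q => ?_
      have hgn := hg.nonneg (m q.1) (m q.2)
      change A * ‖m q.1 - m q.2‖ ≤ 1 / 16 + K * g (m q.1) (m q.2)
      rcases le_or_gt (1 / (16 * A)) ‖m q.1 - m q.2‖ with h | h
      · have h5 := hc₁' _ _ (hm1 _) (hm1 _) h
        calc A * ‖m q.1 - m q.2‖ ≤ A * (R + R) := by
              gcongr
              exact (_root_.norm_sub_le _ _).trans (add_le_add (hmR _) (hmR _))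
          _ = K * c₁ := by rw [hK]; field_simp; ring
          _ ≤ K * g (m q.1) (m q.2) := by gcongr
          _ ≤ _ := by linarith
      · have : A * ‖m q.1 - m q.2‖ ≤ A * (1 / (16 * A)) := by gcongr
        have e : A * (1 / (16 * A)) = 1 / 16 := by field_simp
        have := mul_nonneg hK0.le hgn
        linarith
    rw [integral_add (integrable_const _) (hgi.const_mul K), integral_const_mul K] at h4
    simp only [integral_const, probReal_univ, smul_eq_mul, one_mul] at h4
    have h6 : 1 / 16 ≤ K * D := by linarith
    have h7 : ∫ x, ‖m x - γ θ‖ ∂ν ≤ 2 * R := by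
      calc _ ≤ ∫ _, 2 * R ∂ν := integral_mono hni (integrable_const _) fun x => by
            refine (_root_.norm_sub_le _ _).trans ?_
            linarith [hmR x, hR' _ (hγ.norm_eq_one θ)]
        _ = 2 * R := by simp
    have h8 : 0 ≤ ∫ x, ‖m x - γ θ‖ ∂ν := integral_nonneg fun _ => norm_nonneg _
    calc δ * ∫ x, ‖m x - γ θ‖ ∂ν ≤ 2 * (2 * R) := by gcongr
      _ = 64 * R * (1 / 16) := by ring
      _ ≤ 64 * R * (K * D) := by gcongr
      _ = 64 * R * K * D := by ring
      _ ≤ _ := by gcongr; linarith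
  · -- deep points are rare
    have hpD : p ≤ 2 / c₂ * D := by
      have h1 : ∫ q : ℂ × ℂ, χ q.1 ∂(ν.prod ν) ≤
          ∫ q : ℂ × ℂ, (1 / c₂ * g (m q.1) (m q.2) + χ q.1 * (4 * v q.2)) ∂(ν.prod ν) := by
        refine integral_mono (prodfst hχi)
          ((hgi.const_mul _).add (hχi.mul_prod (hvi.const_mul 4))) fun q => ?_
        have hgn := hg.nonneg (m q.1) (m q.2)
        change χ q.1 ≤ 1 / c₂ * g (m q.1) (m q.2) + χ q.1 * (4 * v q.2)
        rcases le_or_gt (1 / 4) (v q.2) with h | h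
        · have : χ q.1 * 1 ≤ χ q.1 * (4 * v q.2) :=
            mul_le_mul_of_nonneg_left (by linarith) (hχ0 _)
          have : 0 ≤ 1 / c₂ * g (m q.1) (m q.2) := by positivity
          linarith
        · have h0 : 0 ≤ χ q.1 * (4 * v q.2) := mul_nonneg (hχ0 _) (by linarith [hv0 q.2])
          by_cases hd : 1 / 2 < v q.1
          · have h5 := hBv (m q.1) (m q.2)
            have h6 : 1 / (4 * B) ≤ ‖m q.1 - m q.2‖ := by
              rw [div_le_iff₀ (by positivity)]
              have : v q.1 - v q.2 ≤ |v q.1 - v q.2| := le_abs_self _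
              change |v q.1 - v q.2| ≤ _ at h5
              linarith
            have h7 := hc₂' _ _ (hm1 _) (hm1 _) h6
            have h8 : 1 ≤ 1 / c₂ * g (m q.1) (m q.2) := by
              rw [one_div, ← div_eq_inv_mul, le_div_iff₀ hc₂]; linarith
            linarith [hχ1 q.1]
          · have : χ q.1 = 0 := if_neg hd
            rw [this]
            have : 0 ≤ 1 / c₂ * g (m q.1) (m q.2) := by positivity
            linarith
      rw [intfst, integral_add (hgi.const_mul _) (hχi.mul_prod (hvi.const_mul 4)),
        integral_const_mul, integral_prod_mul χ (fun x => 4 * v x), integral_const_mul] at h1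
      change p ≤ 1 / c₂ * D + p * (4 * δ) at h1
      have h2 : p * (4 * δ) ≤ p * (1 / 2) := by gcongr; linarith
      have e : 2 / c₂ * D = 2 * (1 / c₂ * D) := by ring
      rw [e]; linarith
    set a : ℂ → ℝ := fun x => max (-u x) 0 with ha
    set b : ℂ → ℝ := fun x => max (u x) 0 with hb
    set e : ℂ → ℝ := fun x => if u x ≤ 0 then 1 else 0 with he
    have hem : Measurable e :=
      Measurable.ite (measurableSet_le hum measurable_const) measurable_const measurable_const
    have ham : Measurable a := hum.neg.max measurable_const
    have hbm : Measurable b := hum.max measurable_const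
    have hai : Integrable a ν := bdd B ham fun x => by
      rw [abs_of_nonneg (le_max_right _ _)]
      exact max_le ((neg_le_abs _).trans (huB x)) (by linarith)
    have hbi : Integrable b ν := bdd B hbm fun x => by
      rw [abs_of_nonneg (le_max_right _ _)]
      exact max_le ((le_abs_self _).trans (huB x)) (by linarith)
    have he01 : ∀ x, e x = 0 ∨ e x = 1 := fun x => by
      simp only [he]; split_ifs <;> simp
    have hvei : Integrable (fun x => v x * e x) ν := bdd 2 (hvm.mul hem) fun x => by
      rcases he01 x with h | h <;> rw [h]
      · simp
      · rw [mul_one, abs_of_nonneg (hv0 x)]; exact hv2 x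
    have hvei' : Integrable (fun x => v x * (1 - e x)) ν := by
      refine (hvi.sub hvei).congr (Filter.Eventually.of_forall fun x => ?_)
      simp only [Pi.sub_apply]; ring
    have hδsplit : (∫ x, v x * (1 - e x) ∂ν) + ∫ x, v x * e x ∂ν = δ := by
      rw [← integral_add hvei' hvei]
      congr 1; funext x; ring
    have hab : ∫ x, b x ∂ν = ∫ x, a x ∂ν := by
      rw [← sub_eq_zero, ← integral_sub hbi hai, ← hu0]
      congr 1; funext x
      simp only [ha, hb]
      rcases le_total (u x) 0 with h | h
      · rw [max_eq_right h, max_eq_left (by linarith)]; ring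
      · rw [max_eq_left h, max_eq_right (by linarith)]; ring
    set U := ∫ x, a x ∂ν with hU
    have hkey : U * δ ≤ T * (D + p) := by
      have h1 : ∫ q : ℂ × ℂ, (a q.1 * (v q.2 * (1 - e q.2)) + (v q.1 * e q.1) * b q.2) ∂(ν.prod ν)
          ≤ ∫ q : ℂ × ℂ, T * (g (m q.1) (m q.2) + χ q.1) ∂(ν.prod ν) := by
        refine integral_mono ((hai.mul_prod hvei').add (hvei.mul_prod hbi))
          ((hgi.add (prodfst hχi)).const_mul T) fun q => ?_
        change a q.1 * (v q.2 * (1 - e q.2)) + (v q.1 * e q.1) * b q.2 ≤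
          T * (g (m q.1) (m q.2) + χ q.1)
        have hnn : 0 ≤ T * (g (m q.1) (m q.2) + χ q.1) :=
          mul_nonneg hT.le (add_nonneg (hg.nonneg _ _) (hχ0 _))
        by_cases hs1 : u q.1 ≤ 0
        · by_cases hs2 : u q.2 ≤ 0
          · have e2 : e q.2 = 1 := if_pos hs2
            have b2 : b q.2 = 0 := max_eq_right hs2
            rw [e2, b2]; simpa using hnn
          · have e1 : e q.1 = 1 := if_pos hs1
            have e2 : e q.2 = 0 := if_neg hs2
            push Not at hs2
            have b2 : b q.2 = u q.2 := max_eq_left hs2.le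
            have a1 : a q.1 = -u q.1 := max_eq_left (by linarith)
            rw [e1, e2, b2, a1]
            have := hT' θ _ _ (hm1 q.1) (hm1 q.2) hs1 hs2
            refine le_trans (le_of_eq ?_) this
            simp only [hu, hv]; ring
        · have e1 : e q.1 = 0 := if_neg hs1
          push Not at hs1
          have a1 : a q.1 = 0 := max_eq_right (by linarith)
          rw [e1, a1]; simpa using hnn
      rw [integral_add (hai.mul_prod hvei') (hvei.mul_prod hbi),
        integral_prod_mul a (fun x => v x * (1 - e x)),
        integral_prod_mul (fun x => v x * e x) b, integral_const_mul,
        integral_add hgi (prodfst hχi), intfst, hab] at h1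
      rw [← hδsplit, mul_add, mul_comm U (∫ x, v x * e x ∂ν)]
      exact h1
    have hosc : ∫ x, ‖m x - γ θ‖ ∂ν ≤ B * ((1 + B) * (2 * U) + 2 * p) := by
      have h1 : ∫ x, ‖m x - γ θ‖ ∂ν ≤ ∫ x, B * ((1 + B) * (a x + b x) + 2 * χ x) ∂ν := by
        refine integral_mono hni ((((hai.add hbi).const_mul _).add (hχi.const_mul 2)).const_mul B)
          fun x => ?_
        change ‖m x - γ θ‖ ≤ B * ((1 + B) * (a x + b x) + 2 * χ x)
        have habs : a x + b x = |u x| := by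
          simp only [ha, hb]
          rcases le_total (u x) 0 with h | h
          · rw [max_eq_right h, max_eq_left (by linarith), abs_of_nonpos h]; ring
          · rw [max_eq_left h, max_eq_right (by linarith), abs_of_nonneg h]; ring
        refine (hBn _ (hm1 x)).trans ?_
        have := hBd _ (hm1 x)
        rw [habs]
        refine mul_le_mul_of_nonneg_left ?_ (by linarith)
        change v x ≤ B * |u x| + 2 * χ x at this
        change |u x| + v x ≤ _
        linarith
      have habi : Integrable (fun x => a x + b x) ν := hai.add hbi
      rw [integral_const_mul, integral_add (habi.const_mul _) (hχi.const_mul 2),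
        integral_const_mul, integral_const_mul] at h1
      have h2 : ∫ x, (a x + b x) ∂ν = 2 * U := by
        rw [integral_add hai hbi, hab]; ring
      rw [h2] at h1
      exact h1
    have hB0 : 0 < B := by linarith
    calc δ * ∫ x, ‖m x - γ θ‖ ∂ν ≤ δ * (B * ((1 + B) * (2 * U) + 2 * p)) := by gcongr
      _ = 2 * B * (1 + B) * (U * δ) + 2 * B * p * δ := by ring
      _ ≤ 2 * B * (1 + B) * (T * (D + p)) + 2 * B * p * 1 := by gcongr; linarith
      _ ≤ 2 * B * (1 + B) * (T * (D + 2 / c₂ * D)) + 2 * B * (2 / c₂ * D) * 1 := by gcongr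
      _ = (2 * B * (1 + B) * (T * (1 + 2 / c₂)) + 4 * B / c₂) * D := by ring
      _ ≤ _ := by
          gcongr
          have : 0 < 64 * R * K := by positivity
          linarith

end IsArcLengthParam

/-! ### Extension of entropies -/

lemma Function.Periodic.exists_norm_bound {E : Type*} [NormedAddCommGroup E] {f : ℝ → E} {L : ℝ}
    (hL : 0 < L) (hf : Function.Periodic f L) (hc : Continuous f) :
    ∃ M > 0, ∀ t, ‖f t‖ ≤ M := by
  obtain ⟨C, hC⟩ := (isCompact_Icc (a := (0 : ℝ)) (b := L)).exists_bound_of_continuousOn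
    hc.continuousOn
  refine ⟨max C 1, by positivity, fun t => ?_⟩
  obtain ⟨y, hy, e⟩ := hf.exists_mem_Ico₀ hL t
  rw [e]
  exact (hC y (Ico_subset_Icc_self hy)).trans (le_max_left _ _)

lemma Function.Periodic.deriv_periodic {f : ℝ → ℝ} {L : ℝ} (hf : Function.Periodic f L) :
    Function.Periodic (deriv f) L := by
  intro t
  rw [← deriv_comp_add_const]
  congr 1
  funext s
  exact hf s

lemma HasDerivAt.hasFDerivAt_fst {E : Type*} [NormedAddCommGroup E] [NormedSpace ℝ E] {f : ℝ → E}
    {f' : E} {r : ℝ} (hf : HasDerivAt f f' r) (s : ℝ) :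
    HasFDerivAt (fun p : ℝ × ℝ => f p.1)
      ((ContinuousLinearMap.toSpanSingleton ℝ f').comp (ContinuousLinearMap.fst ℝ ℝ ℝ)) (r, s) :=
  HasFDerivAt.comp (g := f) (r, s) hf.hasFDerivAt _root_.hasFDerivAt_fst

lemma HasDerivAt.hasFDerivAt_snd {E : Type*} [NormedAddCommGroup E] [NormedSpace ℝ E] {f : ℝ → E}
    {f' : E} {s : ℝ} (hf : HasDerivAt f f' s) (r : ℝ) :
    HasFDerivAt (fun p : ℝ × ℝ => f p.2)
      ((ContinuousLinearMap.toSpanSingleton ℝ f').comp (ContinuousLinearMap.snd ℝ ℝ ℝ)) (r, s) :=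
  HasFDerivAt.comp (g := f) (r, s) hf.hasFDerivAt _root_.hasFDerivAt_snd

/-- The derivative of polar coordinates `(r, s) ↦ r γ(s)`, where `c = γ(s)` and `τ = γ'(s)`. -/
noncomputable def polarDeriv (c τ : ℂ) (r : ℝ) (h : wedge c τ ≠ 0) (hr : r ≠ 0) :
    (ℝ × ℝ) ≃L[ℝ] ℂ :=
  LinearEquiv.toContinuousLinearEquiv
  { toFun := fun p => p.1 • c + (r * p.2) • τ
    map_add' := fun p q => by simp only [Prod.fst_add, Prod.snd_add, mul_add, add_smul]; abel
    map_smul' := fun a p => by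
      simp only [Prod.smul_fst, Prod.smul_snd, smul_eq_mul, RingHom.id_apply, smul_add, smul_smul]
      ring_nf
    invFun := fun z => (wedge z τ / wedge c τ, wedge c z / wedge c τ / r)
    left_inv := fun p => by
      have h1 : wedge (p.1 • c + (r * p.2) • τ) τ = p.1 * wedge c τ := by
        simp only [wedge_eq, Complex.real_smul, Complex.mul_re, Complex.mul_im, Complex.ofReal_re,
          Complex.ofReal_im, Complex.add_re, Complex.add_im]; ring
      have h2 : wedge c (p.1 • c + (r * p.2) • τ) = r * p.2 * wedge c τ := by
        simp only [wedge_eq, Complex.real_smul, Complex.mul_re, Complex.mul_im, Complex.ofReal_re,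
          Complex.ofReal_im, Complex.add_re, Complex.add_im]; ring
      ext
      · simp only [h1]; field_simp
      · simp only [h2]; field_simp
    right_inv := fun z => by
      simp only
      rw [mul_div_cancel₀ _ hr]
      exact (wedge_decomp h z).symm }

lemma polarDeriv_apply (c τ : ℂ) (r : ℝ) (h : wedge c τ ≠ 0) (hr : r ≠ 0) (p : ℝ × ℝ) :
    polarDeriv c τ r h hr p = p.1 • c + (r * p.2) • τ := rfl

lemma polarDeriv_symm_apply (c τ : ℂ) (r : ℝ) (h : wedge c τ ≠ 0) (hr : r ≠ 0) (z : ℂ) :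
    (polarDeriv c τ r h hr).symm z = (wedge z τ / wedge c τ, wedge c z / wedge c τ / r) := rfl

namespace IsArcLengthParam

variable {N : Seminorm ℝ ℂ} {L : ℝ} {γ : ℝ → ℂ}

lemma hasStrictFDerivAt_polar (hγ : IsArcLengthParam N L γ) {r : ℝ} (hr : r ≠ 0) (s : ℝ) :
    HasStrictFDerivAt (fun p : ℝ × ℝ => p.1 • γ p.2)
      (polarDeriv (γ s) (deriv γ s) r (hγ.wedge_pos s).ne' hr : (ℝ × ℝ) →L[ℝ] ℂ) (r, s) := by
  have h1 : HasStrictDerivAt γ (deriv γ s) s :=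
    hγ.contDiff.contDiffAt.hasStrictDerivAt one_ne_zero
  have h2 : HasStrictFDerivAt (fun p : ℝ × ℝ => γ p.2) _ (r, s) :=
    h1.hasStrictFDerivAt.comp (r, s) hasStrictFDerivAt_snd
  have h3 : HasStrictFDerivAt (fun p : ℝ × ℝ => p.1 • γ p.2) _ (r, s) :=
    hasStrictFDerivAt_fst.smul h2
  refine h3.congr_fderiv ?_
  ext <;> simp [polarDeriv_apply]

/-- A function which in polar coordinates `(r, s) ↦ r γ(s)` is differentiable is differentiable. -/
lemma hasFDerivAt_of_polar (hγ : IsArcLengthParam N L γ) {F : ℂ → ℂ} {H : ℝ × ℝ → ℂ}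
    (hFH : ∀ r s, 0 < r → F (r • γ s) = H (r, s)) {r : ℝ} (hr : 0 < r) (s : ℝ)
    {H' : ℝ × ℝ →L[ℝ] ℂ} (hH : HasFDerivAt H H' (r, s)) :
    HasFDerivAt F (H'.comp ((polarDeriv (γ s) (deriv γ s) r (hγ.wedge_pos s).ne' hr.ne').symm :
      ℂ →L[ℝ] ℝ × ℝ)) (r • γ s) := by
  have hG := hγ.hasStrictFDerivAt_polar hr.ne' s
  have hinv := hG.to_localInverse
  have hval : hG.localInverse (fun p : ℝ × ℝ => p.1 • γ p.2) _ (r, s) (r • γ s) = (r, s) :=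
    hG.localInverse_apply_image
  have hcont : Filter.Tendsto (hG.localInverse (fun p : ℝ × ℝ => p.1 • γ p.2) _ (r, s))
      (nhds (r • γ s)) (nhds (r, s)) := by
    have := hinv.hasFDerivAt.continuousAt.tendsto
    rwa [hval] at this
  have hcomp : HasFDerivAt (H ∘ hG.localInverse (fun p : ℝ × ℝ => p.1 • γ p.2) _ (r, s))
      (H'.comp ((polarDeriv (γ s) (deriv γ s) r (hγ.wedge_pos s).ne' hr.ne').symm :
      ℂ →L[ℝ] ℝ × ℝ)) (r • γ s) := by
    refine HasFDerivAt.comp _ ?_ hinv.hasFDerivAt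
    change HasFDerivAt H H' (hG.localInverse (fun p : ℝ × ℝ => p.1 • γ p.2) _ (r, s) (r • γ s))
    rwa [hval]
  refine hcomp.congr_of_eventuallyEq ?_
  have hpos : ∀ᶠ p : ℝ × ℝ in nhds (r, s), 0 < p.1 :=
    (isOpen_lt continuous_const continuous_fst).mem_nhds hr
  filter_upwards [hcont.eventually hpos, hG.eventually_right_inverse] with z hz hz'
  rw [Function.comp_apply, ← hFH _ _ hz]
  exact congrArg F hz'.symm

/-- Extension of an entropy to the plane. Near `∂B` it is the first order expansion
`Φ(γ) + λ (z - γ)`, at the radial projection `γ` of `z`, whose differential is `λ` times the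
identity up to terms which vanish linearly on `∂B`; the factors `3r² - 2r³` and `r²`, which are
`1` to the required order at `r = 1`, make it differentiable at the origin. -/
theorem exists_entropy_extension (hγ : IsArcLengthParam N L γ)
    (hN_def : ∀ z, N z = 0 → z = 0) {Φ : ℂ → ℂ} (hΦ : IsEntropy L γ Φ) :
    ∃ F : ℂ → ℂ, ∃ ℓ : ℂ → ℝ, ∃ C > 0, (∀ w, N w = 1 → F w = Φ w) ∧ Differentiable ℝ F ∧
      ∀ z, N z ≤ 1 → |ℓ z| ≤ C ∧
        ‖fderiv ℝ F z - ℓ z • ContinuousLinearMap.id ℝ ℂ‖ ≤ C * (1 - N z) := by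
  obtain ⟨hΦ1, lam, hlam, hper, hder⟩ := hΦ
  obtain ⟨κ, hκ, hκ'⟩ := hγ.exists_wedge_lower
  obtain ⟨R, hR, hR'⟩ := hγ.exists_norm_le
  obtain ⟨A, hA, hA'⟩ := N.le_const_mul_norm
  have hL := hγ.length_pos
  obtain ⟨M₀, hM₀, hM₀'⟩ := Function.Periodic.exists_norm_bound (f := fun t => Φ (γ t)) hL
    (fun t => by simp only [hγ.periodic t]) hΦ1.continuous
  obtain ⟨M₁, hM₁, hM₁'⟩ := hper.exists_norm_bound hL hlam.continuous
  obtain ⟨M₂, hM₂, hM₂'⟩ := hper.deriv_periodic.exists_norm_bound hL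
    (hlam.continuous_deriv le_rfl)
  obtain ⟨ϑ, hϑ⟩ : ∃ ϑ : ℂ → ℝ, ∀ w, N w = 1 → γ (ϑ w) = w := by
    refine ⟨fun w => if h : N w = 1 then (hγ.exists_param h).choose else 0, fun w hw => ?_⟩
    simp only [dif_pos hw]
    exact (hγ.exists_param hw).choose_spec.2
  have hlamϑ : ∀ s, lam (ϑ (γ s)) = lam s := by
    intro s
    obtain ⟨n, hn⟩ := hγ.eq_add_int_mul (hϑ (γ s) (hγ.norm_eq_one s))
    conv_rhs => rw [hn, hper.int_mul n]
  set F : ℂ → ℂ := fun z => (3 * N z ^ 2 - 2 * N z ^ 3) • Φ ((N z)⁻¹ • z) +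
    (N z ^ 2 * (N z - 1) * lam (ϑ ((N z)⁻¹ • z))) • ((N z)⁻¹ • z) with hF
  set H : ℝ × ℝ → ℂ := fun p => (3 * p.1 ^ 2 - 2 * p.1 ^ 3) • Φ (γ p.2) +
    (p.1 ^ 2 * (p.1 - 1) * lam p.2) • γ p.2 with hH
  have hNr : ∀ r s : ℝ, 0 < r → N (r • γ s) = r := fun r s hr => by
    rw [map_smul_eq_mul, hγ.norm_eq_one, mul_one, Real.norm_eq_abs, abs_of_pos hr]
  have hproj : ∀ r s : ℝ, 0 < r → (N (r • γ s))⁻¹ • r • γ s = γ s := fun r s hr => by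
    rw [hNr r s hr, smul_smul, inv_mul_cancel₀ hr.ne', one_smul]
  have hFH : ∀ r s : ℝ, 0 < r → F (r • γ s) = H (r, s) := fun r s hr => by
    simp only [hF, hH, hNr r s hr, inv_smul_smul₀ hr.ne', hlamϑ]
  have hFΦ : ∀ w, N w = 1 → F w = Φ w := fun w hw => by
    simp only [hF, hw]; norm_num
  have hpolar : ∀ z, z ≠ 0 → ∃ r : ℝ, 0 < r ∧ ∃ s, z = r • γ s := by
    intro z hz
    have hpos : 0 < N z := lt_of_le_of_ne (apply_nonneg N z) fun h => hz (hN_def z h.symm)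
    obtain ⟨s, -, e⟩ := hγ.exists_param (w := (N z)⁻¹ • z) (by
      rw [map_smul_eq_mul, Real.norm_eq_abs, abs_of_pos (by positivity), inv_mul_cancel₀ hpos.ne'])
    exact ⟨N z, hpos, s, by rw [e, smul_smul, mul_inv_cancel₀ hpos.ne', one_smul]⟩
  -- the differential away from the origin
  have hderiv : ∀ r s : ℝ, 0 < r → ∃ D : ℂ →L[ℝ] ℂ, HasFDerivAt F D (r • γ s) ∧ ∀ v : ℂ,
      D v - lam s • v = (1 - r) • ((wedge v (deriv γ s) / wedge (γ s) (deriv γ s)) •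
        ((6 * r) • Φ (γ s) - ((3 * r + 1) * lam s) • γ s) -
        (wedge (γ s) v / wedge (γ s) (deriv γ s)) •
          (((1 - r) * lam s) • deriv γ s + (r * deriv lam s) • γ s)) := by
    intro r s hr
    have d1 := (hγ.hasDerivAt s).hasFDerivAt_snd r
    have d2 := (hΦ1.differentiable one_ne_zero s).hasDerivAt.hasFDerivAt_snd r
    have d3 := (hlam.differentiable one_ne_zero s).hasDerivAt.hasFDerivAt_snd r
    have d4 : HasFDerivAt (fun p : ℝ × ℝ => 3 * p.1 ^ 2 - 2 * p.1 ^ 3) _ (r, s) :=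
      ((((hasDerivAt_id r).pow 2).const_mul 3).sub
        (((hasDerivAt_id r).pow 3).const_mul 2)).hasFDerivAt_fst s
    have d5 : HasFDerivAt (fun p : ℝ × ℝ => p.1 ^ 2 * (p.1 - 1)) _ (r, s) :=
      (((hasDerivAt_id r).pow 2).mul ((hasDerivAt_id r).sub_const 1)).hasFDerivAt_fst s
    have dH : HasFDerivAt H _ (r, s) := (d4.smul d2).add ((d5.mul d3).smul d1)
    refine ⟨_, hγ.hasFDerivAt_of_polar hFH hr s dH, fun v => ?_⟩
    have hv : lam s • v = lam s • ((wedge v (deriv γ s) / wedge (γ s) (deriv γ s)) • γ s +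
        (wedge (γ s) v / wedge (γ s) (deriv γ s)) • deriv γ s) := by
      rw [← wedge_decomp (hγ.wedge_pos s).ne' v]
    rw [hv]
    generalize hx : wedge v (deriv γ s) / wedge (γ s) (deriv γ s) = x
    generalize hy : wedge (γ s) v / wedge (γ s) (deriv γ s) = y
    have hsymm : (polarDeriv (γ s) (deriv γ s) r (hγ.wedge_pos s).ne' hr.ne').symm v
        = (x, y / r) := by rw [polarDeriv_symm_apply, hx, hy]
    have hrr : (r : ℂ) ≠ 0 := by exact_mod_cast hr.ne'
    simp only [ContinuousLinearMap.comp_apply, ContinuousLinearEquiv.coe_coe, hsymm,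
      add_apply, smul_apply, ContinuousLinearMap.smulRight_apply,
      ContinuousLinearMap.toSpanSingleton_apply,
      ContinuousLinearMap.coe_fst', ContinuousLinearMap.coe_snd', hder,
      Complex.real_smul, smul_eq_mul]
    push_cast
    field_simp
    simp
    ring
  have hzero : HasFDerivAt F (0 : ℂ →L[ℝ] ℂ) 0 := by
    refine Asymptotics.IsBigO.hasFDerivAt (n := 2) ?_ one_lt_two
    refine Asymptotics.IsBigO.of_bound ((3 * M₀ + M₁ * R) * A ^ 2) ?_
    have hnear : ∀ᶠ z : ℂ in nhds 0, A * ‖z‖ < 1 := by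
      have : ContinuousAt (fun z : ℂ => A * ‖z‖) 0 := by fun_prop
      refine this.tendsto.eventually (gt_mem_nhds ?_)
      simp
    filter_upwards [hnear] with z hz
    rw [sub_zero, norm_pow, norm_norm]
    by_cases h0 : z = 0
    · rw [h0]; simp [hF]
    obtain ⟨r, hr, s, rfl⟩ := hpolar z h0
    have hrA := hA' (r • γ s)
    rw [hNr r s hr] at hrA
    have hr1 : r ≤ 1 := by linarith
    rw [hFH r s hr]
    have h1 : |3 * r ^ 2 - 2 * r ^ 3| ≤ 3 * r ^ 2 := by
      have : 0 ≤ r ^ 3 := by positivity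
      rw [abs_of_nonneg (by nlinarith)]; linarith
    have h2 : |r ^ 2 * (r - 1)| ≤ r ^ 2 := by
      rw [abs_mul, abs_of_nonneg (by positivity : 0 ≤ r ^ 2), abs_of_nonpos (by linarith)]
      nlinarith [sq_nonneg r]
    calc ‖H (r, s)‖ ≤ 3 * r ^ 2 * M₀ + r ^ 2 * M₁ * R := by
          refine (norm_add_le _ _).trans ?_
          rw [norm_smul, norm_smul, Real.norm_eq_abs, Real.norm_eq_abs, abs_mul]
          gcongr
          · exact hM₀' s
          · exact hM₁' s
          · exact hR' _ (hγ.norm_eq_one s)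
      _ = (3 * M₀ + M₁ * R) * r ^ 2 := by ring
      _ ≤ (3 * M₀ + M₁ * R) * (A * ‖r • γ s‖) ^ 2 := by gcongr
      _ = _ := by ring
  have hC0 : 0 < 1 / κ * (6 * M₀ + 4 * M₁ * R) + R / κ * (M₁ + M₂ * R) := by positivity
  refine ⟨F, fun z => lam (ϑ ((N z)⁻¹ • z)),
    1 / κ * (6 * M₀ + 4 * M₁ * R) + R / κ * (M₁ + M₂ * R) + M₁, by positivity, hFΦ, ?_, ?_⟩
  · intro z
    by_cases h0 : z = 0
    · rw [h0]; exact hzero.differentiableAt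
    · obtain ⟨r, hr, s, rfl⟩ := hpolar z h0
      obtain ⟨D, hD, -⟩ := hderiv r s hr
      exact hD.differentiableAt
  · intro z hz
    have hℓ : ∀ t, |lam t| ≤ M₁ := hM₁'
    refine ⟨(hℓ _).trans (by linarith), ?_⟩
    by_cases h0 : z = 0
    · rw [h0, hzero.fderiv, zero_sub, norm_neg, norm_smul, map_zero, sub_zero, mul_one,
        ContinuousLinearMap.norm_id, mul_one]
      exact (hℓ _).trans (by linarith)
    obtain ⟨r, hr, s, rfl⟩ := hpolar z h0
    obtain ⟨D, hD, hDv⟩ := hderiv r s hr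
    rw [hNr r s hr] at hz
    simp only [hproj r s hr, hlamϑ]
    rw [hNr r s hr, hD.fderiv]
    have h1r : 0 ≤ 1 - r := by linarith
    refine ContinuousLinearMap.opNorm_le_bound _ (by positivity) fun v => ?_
    rw [sub_apply, smul_apply, ContinuousLinearMap.id_apply, hDv v, norm_smul,
      Real.norm_eq_abs, abs_of_nonneg h1r]
    have hk := hκ' s
    have hk0 := hγ.wedge_pos s
    have b1 : |wedge v (deriv γ s) / wedge (γ s) (deriv γ s)| ≤ 1 / κ * ‖v‖ := by
      rw [abs_div, abs_of_pos hk0, one_div, ← div_eq_inv_mul]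
      gcongr
      refine (abs_wedge_le _ _).trans ?_
      rw [hγ.unit_speed, mul_one]
    have b2 : |wedge (γ s) v / wedge (γ s) (deriv γ s)| ≤ R / κ * ‖v‖ := by
      rw [abs_div, abs_of_pos hk0, div_mul_eq_mul_div]
      gcongr
      refine (abs_wedge_le _ _).trans ?_
      gcongr
      exact hR' _ (hγ.norm_eq_one s)
    have hγR := hR' _ (hγ.norm_eq_one s)
    have b3 : ‖(6 * r) • Φ (γ s) - ((3 * r + 1) * lam s) • γ s‖ ≤ 6 * M₀ + 4 * M₁ * R := by
      refine (_root_.norm_sub_le _ _).trans ?_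
      rw [norm_smul, norm_smul, Real.norm_eq_abs, Real.norm_eq_abs, abs_mul (3 * r + 1),
        abs_of_nonneg (by positivity : 0 ≤ 6 * r), abs_of_nonneg (by positivity : 0 ≤ 3 * r + 1)]
      gcongr
      · linarith
      · exact hM₀' s
      · linarith
      · exact hℓ s
    have b4 : ‖((1 - r) * lam s) • deriv γ s + (r * deriv lam s) • γ s‖ ≤ M₁ + M₂ * R := by
      refine (norm_add_le _ _).trans ?_
      rw [norm_smul, norm_smul, Real.norm_eq_abs, Real.norm_eq_abs, abs_mul, abs_mul,
        abs_of_nonneg h1r, abs_of_pos hr, hγ.unit_speed, mul_one]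
      have h2 : |deriv lam s| ≤ M₂ := hM₂' s
      have h3 : (1 - r) * |lam s| ≤ 1 * M₁ := by gcongr; linarith; exact hℓ s
      have h4 : r * |deriv lam s| ≤ 1 * M₂ := by gcongr
      rw [one_mul] at h3 h4
      gcongr
    calc _ ≤ (1 - r) * (1 / κ * ‖v‖ * (6 * M₀ + 4 * M₁ * R) + R / κ * ‖v‖ * (M₁ + M₂ * R)) := by
          gcongr
          refine (_root_.norm_sub_le _ _).trans ?_
          rw [norm_smul, norm_smul, Real.norm_eq_abs, Real.norm_eq_abs]
          gcongr
      _ = (1 / κ * (6 * M₀ + 4 * M₁ * R) + R / κ * (M₁ + M₂ * R)) * (1 - r) * ‖v‖ := by ring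
      _ ≤ _ := mul_le_mul_of_nonneg_right
          (mul_le_mul_of_nonneg_right (by linarith) h1r) (norm_nonneg v)

end IsArcLengthParam

/-! ### Mollification -/

/-- A smooth averaging kernel at scale `ρ`: nonnegative, of integral one, supported in the ball of
radius `ρ`, with the natural bounds on the kernel and its differential. -/
structure IsMollifier (C : ℝ) (k : ℂ → ℝ) (ρ : ℝ) : Prop where
  pos : 0 < ρ
  contDiff : ContDiff ℝ (⊤ : ℕ∞) k
  nonneg : ∀ x, 0 ≤ k x
  integral_eq_one : ∫ x, k x = 1
  tsupport_subset : tsupport k ⊆ Metric.closedBall 0 ρ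
  le : ∀ x, k x ≤ C / volume.real (Metric.closedBall (0 : ℂ) ρ)
  norm_fderiv_le : ∀ x, ‖fderiv ℝ k x‖ ≤ C / ρ / volume.real (Metric.closedBall (0 : ℂ) ρ)

/-- The bump function equal to `1` on the ball of radius `ε` and supported in that of radius
`2 ε`. -/
noncomputable def scaledBump (ε : ℝ) (hε : 0 < ε) : ContDiffBump (0 : ℂ) :=
  ⟨ε, 2 * ε, hε, by linarith⟩

lemma volume_real_closedBall_pos {ρ : ℝ} (hρ : 0 < ρ) :
    0 < volume.real (Metric.closedBall (0 : ℂ) ρ) :=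
  ENNReal.toReal_pos (Metric.measure_closedBall_pos volume 0 hρ).ne'
    measure_closedBall_lt_top.ne

lemma exists_isMollifier_scaledBump :
    ∃ C > 0, ∀ ε (hε : 0 < ε), IsMollifier C ((scaledBump ε hε).normed volume) (2 * ε) := by
  obtain ⟨M, hM⟩ := ((scaledBump 1 one_pos).contDiff (n := 1)).continuous_fderiv one_ne_zero
    |>.bounded_above_of_compact_support ((scaledBump 1 one_pos).hasCompactSupport.fderiv ℝ)
  have hM0 : 0 ≤ M := (norm_nonneg _).trans (hM 0)
  refine ⟨4 + 8 * M, by linarith, fun ε hε => ?_⟩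
  have hV := volume_real_closedBall_pos (ρ := 2 * ε) (by linarith)
  have hfr : Module.finrank ℝ ℂ = 2 := Complex.finrank_real_complex
  have hI := (scaledBump ε hε).measure_closedBall_div_le_integral volume 2 le_rfl
  rw [hfr] at hI
  change volume.real (Metric.closedBall (0 : ℂ) (2 * ε)) / 2 ^ 2 ≤ _ at hI
  have hI0 := (scaledBump ε hε).integral_pos (μ := volume)
  refine ⟨by linarith, (scaledBump ε hε).contDiff_normed, (scaledBump ε hε).nonneg_normed,
    (scaledBump ε hε).integral_normed, ?_, fun x => ?_, fun x => ?_⟩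
  · rw [ContDiffBump.tsupport_normed_eq]; exact subset_rfl
  · have h := (scaledBump ε hε).normed_le_div_measure_closedBall_rOut volume 2 le_rfl x
    rw [hfr] at h
    refine h.trans ?_
    change (2 : ℝ) ^ 2 / volume.real (Metric.closedBall (0 : ℂ) (2 * ε)) ≤ _
    gcongr
    linarith
  · have hscale : ∀ y, scaledBump ε hε y = scaledBump 1 one_pos (ε⁻¹ • y) := by
      intro y
      rw [ContDiffBump.apply, ContDiffBump.apply]
      simp only [scaledBump, sub_zero, inv_one, one_smul, div_one, mul_one]
      congr 1
      field_simp
    have hd : HasFDerivAt ((scaledBump ε hε).normed volume)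
        ((∫ y, scaledBump ε hε y)⁻¹ • (fderiv ℝ (scaledBump 1 one_pos) (ε⁻¹ • x)).comp
          (ε⁻¹ • ContinuousLinearMap.id ℝ ℂ)) x := by
      have h1 : HasFDerivAt (fun y : ℂ => ε⁻¹ • y) (ε⁻¹ • ContinuousLinearMap.id ℝ ℂ) x :=
        (hasFDerivAt_id x).const_smul ε⁻¹
      have h2 : HasFDerivAt (scaledBump 1 one_pos)
          (fderiv ℝ (scaledBump 1 one_pos) (ε⁻¹ • x)) (ε⁻¹ • x) :=
        (((scaledBump 1 one_pos).contDiff (n := 1)).differentiable one_ne_zero _).hasFDerivAt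
      have h3 := (h2.comp x h1).const_mul (∫ y, scaledBump ε hε y)⁻¹
      refine h3.congr_of_eventuallyEq (Filter.Eventually.of_forall fun y => ?_)
      rw [ContDiffBump.normed_def, hscale y, div_eq_inv_mul]
      rfl
    rw [hd.fderiv, norm_smul, Real.norm_eq_abs, abs_of_pos (by positivity)]
    calc _ ≤ (∫ y, scaledBump ε hε y)⁻¹ * (M * ε⁻¹) := by
          gcongr
          refine (ContinuousLinearMap.opNorm_comp_le _ _).trans ?_
          gcongr
          · exact hM _
          · rw [norm_smul, ContinuousLinearMap.norm_id, mul_one, Real.norm_eq_abs,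
              abs_of_pos (by positivity)]
      _ ≤ (volume.real (Metric.closedBall (0 : ℂ) (2 * ε)) / 2 ^ 2)⁻¹ * (M * ε⁻¹) := by gcongr
      _ = 8 * M / (2 * ε) / volume.real (Metric.closedBall (0 : ℂ) (2 * ε)) := by
          field_simp; norm_num; ring
      _ ≤ _ := by gcongr; linarith

/-- The normalized Lebesgue measure on the ball of radius `ρ` around the origin. -/
noncomputable def ballMeasure (ρ : ℝ) : Measure ℂ :=
  ProbabilityTheory.cond volume (Metric.closedBall (0 : ℂ) ρ)

lemma isProbabilityMeasure_ballMeasure {ρ : ℝ} (hρ : 0 < ρ) :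
    IsProbabilityMeasure (ballMeasure ρ) :=
  ProbabilityTheory.cond_isProbabilityMeasure_of_finite
    (Metric.measure_closedBall_pos volume 0 hρ).ne' measure_closedBall_lt_top.ne

lemma integral_ballMeasure (ρ : ℝ) (f : ℂ → ℝ) :
    ∫ t, f t ∂(ballMeasure ρ) = (volume.real (Metric.closedBall (0 : ℂ) ρ))⁻¹ *
      ∫ t in Metric.closedBall (0 : ℂ) ρ, f t := by
  rw [ballMeasure, ProbabilityTheory.cond, integral_smul_measure, ENNReal.toReal_inv]
  rfl

/-- The divergence of a vector field on `ℂ ≃ ℝ²`. -/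
noncomputable def divergence (G : ℂ → ℂ) (x : ℂ) : ℝ :=
  (fderiv ℝ G x 1).re + (fderiv ℝ G x Complex.I).im

lemma integrable_smul_of_bounded {E : Type*} [NormedAddCommGroup E] [NormedSpace ℝ E]
    [MeasurableSpace E] [BorelSpace E] [SecondCountableTopology E]
    {h : ℂ → ℝ} (hc : Continuous h) (hs : HasCompactSupport h) {f : ℂ → E}
    (hf : Measurable f) {M : ℝ} (hM : ∀ x, ‖f x‖ ≤ M) : Integrable fun x => h x • f x := by
  have h1 : Integrable fun x => ‖h x‖ * M := (hc.integrable_of_hasCompactSupport hs).norm.mul_const M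
  refine h1.mono' (hc.measurable.smul hf).aestronglyMeasurable
    (Filter.Eventually.of_forall fun x => ?_)
  rw [norm_smul]
  gcongr
  exact hM x

namespace IsMollifier

variable {C ρ : ℝ} {k : ℂ → ℝ} {f : ℂ → ℂ} {M : ℝ}

lemma hasCompactSupport (hk : IsMollifier C k ρ) : HasCompactSupport k :=
  (isCompact_closedBall (0 : ℂ) ρ).of_isClosed_subset (isClosed_tsupport k) hk.tsupport_subset

lemma contDiff_one (hk : IsMollifier C k ρ) : ContDiff ℝ 1 k := hk.contDiff.of_le (by simp)

lemma eq_zero_of_notMem (hk : IsMollifier C k ρ) {t : ℂ} (ht : t ∉ Metric.closedBall (0 : ℂ) ρ) :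
    k t = 0 :=
  image_eq_zero_of_notMem_tsupport fun h => ht (hk.tsupport_subset h)

lemma fderiv_eq_zero_of_notMem (hk : IsMollifier C k ρ) {t : ℂ}
    (ht : t ∉ Metric.closedBall (0 : ℂ) ρ) : fderiv ℝ k t = 0 :=
  image_eq_zero_of_notMem_tsupport fun h => ht (hk.tsupport_subset (tsupport_fderiv_subset ℝ h))

/-- Averages against a function dominated by a multiple of the uniform density. -/
lemma integral_mul_le (hk : IsMollifier C k ρ) {h φ : ℂ → ℝ} {A : ℝ}
    (hh : Measurable h) (hA : ∀ t, |h t| ≤ A / volume.real (Metric.closedBall (0 : ℂ) ρ))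
    (h0 : ∀ t ∉ Metric.closedBall (0 : ℂ) ρ, h t = 0) (hφ : Measurable φ) (hφ0 : ∀ t, 0 ≤ φ t)
    (hφM : ∀ t, φ t ≤ M) :
    ∫ t, |h t| * φ t ≤ A * ∫ t, φ t ∂(ballMeasure ρ) := by
  have hV := volume_real_closedBall_pos hk.pos
  have hfin : volume (Metric.closedBall (0 : ℂ) ρ) < ∞ := measure_closedBall_lt_top
  have hφi : IntegrableOn φ (Metric.closedBall (0 : ℂ) ρ) :=
    Measure.integrableOn_of_bounded hfin.ne hφ.aestronglyMeasurable (M := M)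
      (Filter.Eventually.of_forall fun t => by
        rw [Real.norm_eq_abs, abs_of_nonneg (hφ0 t)]; exact hφM t)
  rw [integral_ballMeasure, ← setIntegral_eq_integral_of_forall_compl_eq_zero
    (s := Metric.closedBall (0 : ℂ) ρ) (fun t ht => by rw [h0 t ht]; simp), ← mul_assoc,
    ← div_eq_mul_inv, ← integral_const_mul]
  refine integral_mono ?_ (hφi.const_mul _) fun t =>
    mul_le_mul_of_nonneg_right (hA t) (hφ0 t)
  refine (hφi.const_mul (A / volume.real (Metric.closedBall (0 : ℂ) ρ))).mono'
    (hh.abs.mul hφ).aestronglyMeasurable (Filter.Eventually.of_forall fun t => ?_)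
  rw [Real.norm_eq_abs, abs_of_nonneg (mul_nonneg (abs_nonneg _) (hφ0 t))]
  exact mul_le_mul_of_nonneg_right (hA t) (hφ0 t)

/-- The mollification of a vector field. -/
noncomputable def _root_.mollify (k : ℂ → ℝ) (f : ℂ → ℂ) (x : ℂ) : ℂ :=
  convolution k f (ContinuousLinearMap.lsmul ℝ ℝ) volume x

lemma _root_.mollify_eq (k : ℂ → ℝ) (f : ℂ → ℂ) (x : ℂ) :
    mollify k f x = ∫ t, k t • f (x - t) := rfl

lemma _root_.locallyIntegrable_of_bounded (hf : Measurable f) (hM : ∀ x, ‖f x‖ ≤ M) :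
    LocallyIntegrable f := by
  have h : LocallyIntegrable (fun _ : ℂ => M) := locallyIntegrable_const M
  exact h.mono hf.aestronglyMeasurable (Filter.Eventually.of_forall fun x =>
    (hM x).trans (le_abs_self M))

lemma hasFDerivAt_mollify (hk : IsMollifier C k ρ) (hf : Measurable f) (hM : ∀ x, ‖f x‖ ≤ M)
    (x : ℂ) : ∃ D : ℂ →L[ℝ] ℂ, HasFDerivAt (mollify k f) D x ∧
      ∀ v, D v = ∫ t, (fderiv ℝ k t v) • f (x - t) := by
  have hl := locallyIntegrable_of_bounded hf hM
  refine ⟨_, hk.hasCompactSupport.hasFDerivAt_convolution_left (ContinuousLinearMap.lsmul ℝ ℝ)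
    hk.contDiff_one hl x, fun v => ?_⟩
  have hex := (hk.hasCompactSupport.fderiv ℝ).convolutionExists_left
    (ContinuousLinearMap.precompL ℂ (ContinuousLinearMap.lsmul ℝ ℝ : ℝ →L[ℝ] ℂ →L[ℝ] ℂ))
    (hk.contDiff_one.continuous_fderiv one_ne_zero) hl x
  rw [convolution_def, ContinuousLinearMap.integral_apply hex]
  rfl

lemma differentiable_mollify (hk : IsMollifier C k ρ) (hf : Measurable f) (hM : ∀ x, ‖f x‖ ≤ M) :
    Differentiable ℝ (mollify k f) := fun x =>
  (hk.hasFDerivAt_mollify hf hM x).choose_spec.1.differentiableAt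

lemma continuous_fderiv_apply (hk : IsMollifier C k ρ) (v : ℂ) :
    Continuous fun t => fderiv ℝ k t v :=
  (hk.contDiff_one.continuous_fderiv one_ne_zero).clm_apply continuous_const

lemma hasCompactSupport_fderiv_apply (hk : IsMollifier C k ρ) (v : ℂ) :
    HasCompactSupport fun t => fderiv ℝ k t v :=
  hk.hasCompactSupport.fderiv_apply ℝ v

lemma integrable_fderiv_smul (hk : IsMollifier C k ρ) (hf : Measurable f) (hM : ∀ x, ‖f x‖ ≤ M)
    (x v : ℂ) : Integrable fun t => (fderiv ℝ k t v) • f (x - t) :=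
  integrable_smul_of_bounded (hk.continuous_fderiv_apply v) (hk.hasCompactSupport_fderiv_apply v)
    (hf.comp (measurable_const.sub measurable_id)) fun _ => hM _

/-- The differential of a mollification is controlled by the mean oscillation around any point. -/
lemma norm_fderiv_mollify_le (hk : IsMollifier C k ρ) (hf : Measurable f) (hM : ∀ x, ‖f x‖ ≤ M)
    (x c : ℂ) :
    ‖fderiv ℝ (mollify k f) x‖ ≤ C / ρ * ∫ t, ‖f (x - t) - c‖ ∂(ballMeasure ρ) := by
  have hf' : Measurable fun y => f y - c := hf.sub measurable_const
  have hM' : ∀ y, ‖f y - c‖ ≤ M + ‖c‖ := fun y =>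
    (norm_sub_le _ _).trans (by gcongr; exact hM y)
  obtain ⟨D, hD, hDv⟩ := hk.hasFDerivAt_mollify hf' hM' x
  -- subtracting a constant does not change the differential
  have hsub : mollify k f = fun y => mollify k (fun y => f y - c) y + c := by
    funext y
    have hi : Integrable fun t => k t • f (y - t) :=
      integrable_smul_of_bounded hk.contDiff.continuous hk.hasCompactSupport
        (hf.comp (measurable_const.sub measurable_id)) fun _ => hM _
    have hi' := integrable_smul_of_bounded hk.contDiff.continuous hk.hasCompactSupport
      (measurable_const : Measurable fun _ : ℂ => c) fun _ => le_rfl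
    rw [mollify_eq, mollify_eq]
    simp only [smul_sub]
    rw [integral_sub hi hi', integral_smul_const, hk.integral_eq_one, one_smul]
    simp
  have hφm : Measurable fun t => ‖f (x - t) - c‖ :=
    (hf'.comp (measurable_const.sub measurable_id)).norm
  have hdm : Measurable fun t => ‖fderiv ℝ k t‖ :=
    (hk.contDiff_one.continuous_fderiv one_ne_zero).norm.measurable
  rw [hsub, (hD.add_const c).fderiv]
  have hrhs : 0 ≤ C / ρ * ∫ t, ‖f (x - t) - c‖ ∂(ballMeasure ρ) := by
    have h1 := (norm_nonneg _).trans (hk.norm_fderiv_le 0)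
    have h2 : 0 ≤ C / ρ := by
      rw [le_div_iff₀ (volume_real_closedBall_pos hk.pos), zero_mul] at h1
      exact h1
    exact mul_nonneg h2 (integral_nonneg fun _ => norm_nonneg _)
  refine ContinuousLinearMap.opNorm_le_bound _ hrhs fun v => ?_
  rw [hDv v]
  calc ‖∫ t, (fderiv ℝ k t v) • (f (x - t) - c)‖
      ≤ ∫ t, ‖(fderiv ℝ k t v) • (f (x - t) - c)‖ := norm_integral_le_integral_norm _
    _ ≤ ∫ t, (|‖fderiv ℝ k t‖| * ‖f (x - t) - c‖) * ‖v‖ := by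
        refine integral_mono (hk.integrable_fderiv_smul hf' hM' x v).norm ?_ fun t => ?_
        · refine Integrable.mul_const ?_ _
          have := integrable_smul_of_bounded
            (hk.contDiff_one.continuous_fderiv one_ne_zero).norm
            (hk.hasCompactSupport.fderiv ℝ).norm
            (hf'.comp (measurable_const.sub measurable_id : Measurable fun t => x - t)).norm
            (fun t => by rw [norm_norm]; exact hM' (x - t))
          simpa using this
        · simp only [norm_smul, abs_norm]
          have := (fderiv ℝ k t).le_opNorm v
          nlinarith [norm_nonneg (f (x - t) - c)]
    _ ≤ _ := by
        rw [integral_mul_const]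
        gcongr
        exact hk.integral_mul_le hdm (fun t => by rw [abs_norm]; exact hk.norm_fderiv_le t)
          (fun t ht => by rw [hk.fderiv_eq_zero_of_notMem ht, norm_zero]) hφm
          (fun _ => norm_nonneg _) (fun _ => hM' _)

/-- If `∇ · f = 0` on `Ω` in the sense of distributions, then `∇ · (k ⋆ f) = 0` at the points whose
distance to the complement of `Ω` exceeds the range of the kernel. -/
lemma divergence_mollify_eq_zero (hk : IsMollifier C k ρ) {Ω : Opens ℂ}
    (hf : Measurable f) (hM : ∀ x, ‖f x‖ ≤ M) (hdiv : ∀ ζ : 𝓓(Ω, ℝ), divPairing Ω f ζ = 0)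
    {x : ℂ} (hx : Metric.closedBall x ρ ⊆ Ω) : divergence (mollify k f) x = 0 := by
  obtain ⟨D, hD, hDv⟩ := hk.hasFDerivAt_mollify hf hM x
  have h1 : divergence (mollify k f) x = ∫ t, fderiv ℝ k t (f (x - t)) := by
    rw [divergence, hD.fderiv, hDv, hDv]
    have i1 := hk.integrable_fderiv_smul hf hM x 1
    have i2 := hk.integrable_fderiv_smul hf hM x Complex.I
    have e1 := Complex.reCLM.integral_comp_comm i1
    have e2 := Complex.imCLM.integral_comp_comm i2
    simp only [Complex.reCLM_apply, Complex.imCLM_apply] at e1 e2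
    rw [← e1, ← e2, ← integral_add]
    · congr 1; funext t
      have hz : f (x - t) = (f (x - t)).re • (1 : ℂ) + (f (x - t)).im • Complex.I := by
        simp [Complex.re_add_im]
      conv_rhs => rw [hz, map_add, map_smul, map_smul]
      simp only [Complex.real_smul, smul_eq_mul, Complex.re_ofReal_mul, Complex.im_ofReal_mul]
      ring
    · exact Complex.reCLM.integrable_comp i1
    · exact Complex.imCLM.integrable_comp i2
  have hsupp : tsupport (fun t => k (x - t)) ⊆ Metric.closedBall x ρ := by
    refine closure_minimal (fun t ht => ?_) Metric.isClosed_closedBall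
    by_contra hn
    refine ht (hk.eq_zero_of_notMem fun h => hn ?_)
    rw [mem_closedBall_zero_iff] at h
    rwa [Metric.mem_closedBall, dist_comm, dist_eq_norm]
  have hsm : ContDiff ℝ (⊤ : ℕ∞) fun t => k (x - t) :=
    hk.contDiff.comp (contDiff_const.sub contDiff_id)
  have hcs : HasCompactSupport fun t => k (x - t) :=
    (isCompact_closedBall x ρ).of_isClosed_subset (isClosed_tsupport _) hsupp
  have hder : ∀ t, fderiv ℝ (fun t => k (x - t)) t = -fderiv ℝ k (x - t) := by
    intro t
    have h2 : HasFDerivAt (fun t : ℂ => x - t) (-ContinuousLinearMap.id ℝ ℂ) t :=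
      (hasFDerivAt_id t).const_sub x
    have h3 := ((hk.contDiff_one.differentiable one_ne_zero (x - t)).hasFDerivAt.comp t h2).fderiv
    rw [ContinuousLinearMap.comp_neg, ContinuousLinearMap.comp_id] at h3
    exact h3
  have h4 := hdiv ⟨fun t => k (x - t), hsm, hcs, hsupp.trans hx⟩
  have h5 : -∫ t in (Ω : Set ℂ), fderiv ℝ (fun t => k (x - t)) t (f t) = 0 := h4
  simp only [hder, neg_apply, integral_neg, neg_neg] at h5
  rw [setIntegral_eq_integral_of_forall_compl_eq_zero] at h5
  · rw [h1, ← h5, ← integral_sub_left_eq_self (fun t => fderiv ℝ k t (f (x - t))) volume x]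
    simp
  · intro t ht
    rw [hk.fderiv_eq_zero_of_notMem, zero_apply]
    intro h
    refine ht (hx ?_)
    rw [mem_closedBall_zero_iff] at h
    rwa [Metric.mem_closedBall, dist_comm, dist_eq_norm]

end IsMollifier

namespace IsArcLengthParam

variable {N : Seminorm ℝ ℂ} {L : ℝ} {γ : ℝ → ℂ}

/-- The depth of a mollification is the average of the depth. -/
lemma depth_mollify {C ρ : ℝ} {k : ℂ → ℝ} (hk : IsMollifier C k ρ) {m : ℂ → ℂ}
    {R : ℝ} (hm : Measurable m) (hmR : ∀ x, ‖m x‖ ≤ R) (θ : ℝ) (x : ℂ) :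
    depth γ θ (mollify k m x) = ∫ t, k t * depth γ θ (m (x - t)) := by
  have hi : Integrable fun t => k t • m (x - t) :=
    integrable_smul_of_bounded hk.contDiff.continuous hk.hasCompactSupport
      (hm.comp (measurable_const.sub measurable_id)) fun _ => hmR _
  have hi' : Integrable fun t => wedge (k t • m (x - t)) (deriv γ θ) :=
    Complex.imCLM.integrable_comp
      ((Complex.conjCLE.toContinuousLinearMap.integrable_comp hi).mul_const (deriv γ θ))
  have hki : Integrable k :=
    hk.contDiff.continuous.integrable_of_hasCompactSupport hk.hasCompactSupport
  rw [depth, mollify_eq, ← wedge_integral_left hi, ← integral_div]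
  conv_lhs => rw [← hk.integral_eq_one]
  rw [← integral_sub hki (Integrable.div_const hi' _)]
  congr 1; funext t
  rw [depth, wedge_smul_left]
  ring

end IsArcLengthParam

/-! ### Entropy production of mollified solutions -/

lemma abs_trace_le_two_mul_norm (A : ℂ →L[ℝ] ℂ) : |(A 1).re + (A Complex.I).im| ≤ 2 * ‖A‖ := by
  have h1 := (Complex.abs_re_le_norm (A 1)).trans (A.le_opNorm 1)
  have h2 := (Complex.abs_im_le_norm (A Complex.I)).trans (A.le_opNorm Complex.I)
  rw [norm_one, mul_one] at h1
  rw [Complex.norm_I, mul_one] at h2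
  exact (abs_add_le _ _).trans (by linarith)

namespace IsArcLengthParam

variable {N : Seminorm ℝ ℂ} {L : ℝ} {γ : ℝ → ℂ}

lemma norm_mollify_le_one (hγ : IsArcLengthParam N L γ) (hN_def : ∀ z, N z = 0 → z = 0)
    {C ρ : ℝ} {k : ℂ → ℝ} (hk : IsMollifier C k ρ) {m : ℂ → ℂ}
    (hm : Measurable m) (hm1 : ∀ x, N (m x) = 1) (x : ℂ) : N (mollify k m x) ≤ 1 := by
  obtain ⟨R, -, hR'⟩ := hγ.exists_norm_le
  obtain ⟨θ, hθ⟩ := hγ.exists_radial hN_def (mollify k m x)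
  have h := depth_mollify (γ := γ) hk hm (fun x => hR' _ (hm1 x)) θ x
  have h0 : 0 ≤ ∫ t, k t * depth γ θ (m (x - t)) :=
    integral_nonneg fun t => mul_nonneg (hk.nonneg t) (hγ.depth_nonneg θ (hm1 _).le)
  rw [← h, hθ, hγ.depth_smul] at h0
  linarith

/-- The commutator estimate. Since the differential of the extended entropy is a multiple of the
identity up to an error of size `1 - N`, and the mollified field is divergence free, the entropy
production of the latter is at most its depth times its differential; both are averages over a ball,
and their product is controlled by the anisotropic variance estimate. -/
theorem exists_divergence_comp_mollify_le (hγ : IsArcLengthParam N L γ)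
    (hN_def : ∀ z, N z = 0 → z = 0) {α : ℝ → ℝ} {g : ℂ → ℂ → ℝ} (hg : IsPairMinorant N L γ α g)
    {F : ℂ → ℂ} {ℓ : ℂ → ℝ} {B : ℝ} (hF : Differentiable ℝ F)
    (hFℓ : ∀ z, N z ≤ 1 → |ℓ z| ≤ B ∧
      ‖fderiv ℝ F z - ℓ z • ContinuousLinearMap.id ℝ ℂ‖ ≤ B * (1 - N z)) {C : ℝ} (hC : 0 < C) :
    ∃ A > 0, ∀ (k : ℂ → ℝ) (ρ : ℝ), IsMollifier C k ρ → ∀ m : ℂ → ℂ, Measurable m →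
      (∀ x, N (m x) = 1) → ∀ x,
        ‖fderiv ℝ (fun y => F (mollify k m y)) x‖ ≤ A / ρ ∧
        (divergence (mollify k m) x = 0 →
          |divergence (fun y => F (mollify k m y)) x| ≤
            A / ρ * ∫ p, g (m (x - p.1)) (m (x - p.2)) ∂((ballMeasure ρ).prod (ballMeasure ρ))) := by
  obtain ⟨R, hR, hR'⟩ := hγ.exists_norm_le
  obtain ⟨V, hV, hV'⟩ := hγ.exists_depth_mul_oscillation_le hN_def hg
  have hB : 0 ≤ B := (abs_nonneg _).trans (hFℓ 0 (by simp)).1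
  refine ⟨2 * B * (C * R) + 2 * B * (C * C) * V + 1, by positivity,
    fun k ρ hk m hm hm1 x => ?_⟩
  have hρ := hk.pos
  have := isProbabilityMeasure_ballMeasure hρ
  have hmR : ∀ x, ‖m x‖ ≤ R := fun x => hR' _ (hm1 x)
  have hz := hγ.norm_mollify_le_one hN_def hk hm hm1 x
  obtain ⟨hℓ, hE⟩ := hFℓ _ hz
  set z := mollify k m x with hzdef
  set E := fderiv ℝ F z - ℓ z • ContinuousLinearMap.id ℝ ℂ with hEdef
  set D := fderiv ℝ (mollify k m) x with hD
  have hcomp : fderiv ℝ (fun y => F (mollify k m y)) x = (fderiv ℝ F z).comp D :=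
    fderiv_comp x (hF _) (hk.differentiable_mollify hm hmR x)
  have hxm : Measurable fun t => m (x - t) := hm.comp (measurable_const.sub measurable_id)
  constructor
  · have h1 : ‖D‖ ≤ C / ρ * R := by
      have h := hk.norm_fderiv_mollify_le hm hmR x 0
      refine h.trans ?_
      gcongr
      calc ∫ t, ‖m (x - t) - 0‖ ∂(ballMeasure ρ) ≤ ∫ _, R ∂(ballMeasure ρ) := by
            refine integral_mono ?_ (integrable_const _) fun t => by simpa using hmR (x - t)
            refine Integrable.of_bound (hxm.sub measurable_const).norm.aestronglyMeasurable R
              (Filter.Eventually.of_forall fun t => by simpa using hmR (x - t))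
        _ = R := by simp
    have h2 : ‖fderiv ℝ F z‖ ≤ 2 * B := by
      have e : fderiv ℝ F z = E + ℓ z • ContinuousLinearMap.id ℝ ℂ := by rw [hEdef]; abel
      rw [e]
      refine (norm_add_le _ _).trans ?_
      rw [norm_smul, ContinuousLinearMap.norm_id, mul_one, Real.norm_eq_abs]
      have := mul_le_mul_of_nonneg_left (by linarith [apply_nonneg N z] : 1 - N z ≤ 1) hB
      linarith
    rw [hcomp]
    calc _ ≤ 2 * B * (C / ρ * R) := by
          refine (ContinuousLinearMap.opNorm_comp_le _ _).trans ?_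
          gcongr
      _ = 2 * B * (C * R) / ρ := by ring
      _ ≤ _ := by
          gcongr
          have : 0 ≤ 2 * B * (C * C) * V := by positivity
          linarith
  · intro hdiv
    obtain ⟨θ, hθ⟩ := hV' (ballMeasure ρ) (fun t => m (x - t)) hxm fun t => hm1 _
    have hdm : Measurable fun t => depth γ θ (m (x - t)) :=
      (continuous_depth γ θ).measurable.comp hxm
    have hd0 : ∀ t, 0 ≤ depth γ θ (m (x - t)) := fun t => hγ.depth_nonneg θ (hm1 _).le
    have h1 : 1 - N z ≤ C * ∫ t, depth γ θ (m (x - t)) ∂(ballMeasure ρ) := by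
      calc 1 - N z ≤ depth γ θ z := by linarith [hγ.one_sub_depth_le θ z]
        _ = ∫ t, |k t| * depth γ θ (m (x - t)) := by
            rw [hzdef, depth_mollify hk hm hmR θ x]
            congr 1; funext t
            rw [abs_of_nonneg (hk.nonneg t)]
        _ ≤ _ := hk.integral_mul_le hk.contDiff.continuous.measurable
            (fun t => by rw [abs_of_nonneg (hk.nonneg t)]; exact hk.le t)
            (fun t ht => hk.eq_zero_of_notMem ht) hdm hd0
            (fun t => hγ.depth_le_two θ (hm1 _).le)
    have h2 : ‖D‖ ≤ C / ρ * ∫ t, ‖m (x - t) - γ θ‖ ∂(ballMeasure ρ) :=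
      hk.norm_fderiv_mollify_le hm hmR x (γ θ)
    have h3 : divergence (fun y => F (mollify k m y)) x =
        ((E.comp D) 1).re + ((E.comp D) Complex.I).im := by
      have e : fderiv ℝ F z = E + ℓ z • ContinuousLinearMap.id ℝ ℂ := by rw [hEdef]; abel
      rw [divergence, ← hD] at hdiv
      rw [divergence, hcomp, e]
      simp only [ContinuousLinearMap.comp_apply, add_apply, smul_apply,
        ContinuousLinearMap.id_apply, Complex.add_re, Complex.add_im, Complex.real_smul,
        Complex.re_ofReal_mul, Complex.im_ofReal_mul]
      linear_combination ℓ z * hdiv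
    have hnn : 0 ≤ ∫ p : ℂ × ℂ, g (m (x - p.1)) (m (x - p.2))
        ∂((ballMeasure ρ).prod (ballMeasure ρ)) := integral_nonneg fun p => hg.nonneg _ _
    have hdI : 0 ≤ ∫ t, depth γ θ (m (x - t)) ∂(ballMeasure ρ) := integral_nonneg hd0
    rw [h3]
    calc _ ≤ 2 * ‖E.comp D‖ := abs_trace_le_two_mul_norm _
      _ ≤ 2 * ((B * (C * ∫ t, depth γ θ (m (x - t)) ∂(ballMeasure ρ))) *
            (C / ρ * ∫ t, ‖m (x - t) - γ θ‖ ∂(ballMeasure ρ))) := by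
          gcongr
          refine (ContinuousLinearMap.opNorm_comp_le _ _).trans ?_
          gcongr
          exact hE.trans (by gcongr)
      _ = 2 * B * (C * C) / ρ * ((∫ t, depth γ θ (m (x - t)) ∂(ballMeasure ρ)) *
            ∫ t, ‖m (x - t) - γ θ‖ ∂(ballMeasure ρ)) := by ring
      _ ≤ 2 * B * (C * C) / ρ * (V * ∫ p, g (m (x - p.1)) (m (x - p.2))
            ∂((ballMeasure ρ).prod (ballMeasure ρ))) := by gcongr
      _ = 2 * B * (C * C) * V / ρ * ∫ p, g (m (x - p.1)) (m (x - p.2))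
            ∂((ballMeasure ρ).prod (ballMeasure ρ)) := by ring
      _ ≤ _ := by
          gcongr
          have : 0 ≤ 2 * B * (C * R) := by positivity
          linarith

lemma _root_.Seminorm.continuous_of_complex (N : Seminorm ℝ ℂ) : Continuous fun z => N z := by
  obtain ⟨A, hA, hA'⟩ := N.le_const_mul_norm
  refine (LipschitzWith.of_dist_le_mul (K := A.toNNReal) fun x y => ?_).continuous
  rw [Real.dist_eq, dist_eq_norm, Real.coe_toNNReal A hA.le]
  exact (abs_sub_map_le_sub N x y).trans (hA' _)

/-- An eikonal solution has a Borel representative with values in `∂B` everywhere. -/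
lemma exists_representative (hγ : IsArcLengthParam N L γ) {Ω : Opens ℂ} {m : ℂ → ℂ}
    (hm : IsEikonalSolution N Ω m) :
    ∃ m' : ℂ → ℂ, Measurable m' ∧ (∀ x, N (m' x) = 1) ∧
      ∀ᵐ x, x ∈ (Ω : Set ℂ) → m' x = m x := by
  have hNm := N.continuous_of_complex.measurable
  refine ⟨fun x => if N (hm.aemeasurable.mk m x) = 1 then hm.aemeasurable.mk m x else γ 0,
    ?_, fun x => ?_, ?_⟩
  · refine Measurable.ite ?_ hm.aemeasurable.measurable_mk measurable_const
    exact (hNm.comp hm.aemeasurable.measurable_mk) (measurableSet_singleton 1)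
  · dsimp only
    split_ifs with h
    · exact h
    · exact hγ.norm_eq_one 0
  · rw [← ae_restrict_iff' Ω.isOpen.measurableSet]
    filter_upwards [hm.aemeasurable.ae_eq_mk, hm.norm_eq_one] with x h1 h2
    rw [if_pos (by rw [← h1]; exact h2), ← h1]

/-- The regularity estimate for the translates of the representative, on a compact set. -/
lemma exists_translate_bound {α : ℝ → ℝ} {g : ℂ → ℂ → ℝ} (hg : IsPairMinorant N L γ α g)
    {Ω : Opens ℂ} {m m' : ℂ → ℂ} (hreg : RegularityEstimate Ω L γ α m)
    (hmm : ∀ᵐ x, x ∈ (Ω : Set ℂ) → m' x = m x)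
    {K : Set ℂ} (hK : IsCompact K) (hKΩ : K ⊆ Ω) :
    ∃ δ > 0, ∃ M : ℝ≥0∞, M < ∞ ∧ Metric.cthickening δ K ⊆ Ω ∧
      ∀ p₁ p₂ : ℂ, ‖p₁‖ ≤ δ → ‖p₂‖ ≤ δ →
        ∫⁻ x in K, ENNReal.ofReal (g (m' (x - p₁)) (m' (x - p₂))) ≤ M * ‖p₂ - p₁‖ₑ := by
  obtain ⟨δ, hδ, hδΩ⟩ := hK.exists_cthickening_subset_open Ω.isOpen hKΩ
  have hcl : closure (Metric.thickening (δ / 2) K) ⊆ Metric.cthickening (δ / 2) K :=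
    Metric.closure_thickening_subset_cthickening _ _
  have hsub : Metric.cthickening (δ / 2) K ⊆ Ω :=
    (Metric.cthickening_mono (by linarith) _).trans hδΩ
  set Ω' : Opens ℂ := ⟨Metric.thickening (δ / 2) K, Metric.isOpen_thickening⟩
  have hM := hreg Ω' (hK.cthickening.of_isClosed_subset isClosed_closure hcl) (hcl.trans hsub)
  set M := ⨆ (h : ℂ) (_ : h ≠ 0) (_ : ‖h‖ₑ < distToBoundary Ω Ω'),
      ‖h‖ₑ⁻¹ * ∫⁻ x in (Ω' : Set ℂ), anisoMetric L γ α (m (x + h)) (m x) with hMdef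
  refine ⟨δ / 8, by positivity, M, hM, (Metric.cthickening_mono (by linarith) _).trans hδΩ,
    fun p₁ p₂ h₁ h₂ => ?_⟩
  set h := p₂ - p₁ with hh
  have hhn : ‖h‖ ≤ δ / 4 := (_root_.norm_sub_le _ _).trans (by linarith)
  by_cases h0 : h = 0
  · have : p₁ = p₂ := (sub_eq_zero.1 h0).symm
    rw [this]
    simp [hg.diag]
  have hdist : ‖h‖ₑ < distToBoundary Ω Ω' := by
    have h3 : ‖h‖ₑ < ENNReal.ofReal (δ / 2) := by
      rw [← ofReal_norm]
      exact (ENNReal.ofReal_lt_ofReal_iff (by positivity)).2 (by linarith)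
    refine h3.trans_le (le_iInf₂ fun x hx => Metric.le_infEDist.2 fun y hy => ?_)
    by_contra! hlt
    have hyΩ : y ∉ (Ω : Set ℂ) := by
      have := hy.2
      rwa [Ω.isOpen.interior_eq] at this
    refine hyΩ (hδΩ ?_)
    rw [Metric.mem_cthickening_iff]
    have hx' : Metric.infEDist x K < ENNReal.ofReal (δ / 2) := hx
    calc Metric.infEDist y K ≤ Metric.infEDist x K + edist y x := Metric.infEDist_le_infEDist_add_edist
      _ ≤ ENNReal.ofReal (δ / 2) + ENNReal.ofReal (δ / 2) := by
          rw [edist_comm]; gcongr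
      _ = ENNReal.ofReal δ := by
          rw [← ENNReal.ofReal_add (by positivity) (by positivity)]; congr 1; ring
  have hMh : ∫⁻ x in (Ω' : Set ℂ), anisoMetric L γ α (m (x + h)) (m x) ≤ M * ‖h‖ₑ := by
    have h3 : ‖h‖ₑ⁻¹ * ∫⁻ x in (Ω' : Set ℂ), anisoMetric L γ α (m (x + h)) (m x) ≤ M :=
      le_iSup_of_le h (le_iSup_of_le h0 (le_iSup_of_le hdist le_rfl))
    have h4 : ‖h‖ₑ ≠ 0 := by simpa using h0
    rw [← ENNReal.div_eq_inv_mul] at h3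
    exact (ENNReal.div_le_iff h4 (by simp)).1 h3
  refine le_trans ?_ hMh
  -- translate by `p₂`
  have htr : ∫⁻ x in K, ENNReal.ofReal (g (m' (x - p₁)) (m' (x - p₂))) ≤
      ∫⁻ x in (Ω' : Set ℂ), ENNReal.ofReal (g (m' (x + h)) (m' x)) := by
    rw [← lintegral_indicator hK.measurableSet, ← lintegral_indicator Ω'.isOpen.measurableSet,
      ← lintegral_sub_right_eq_self (fun x => (Ω' : Set ℂ).indicator
        (fun x => ENNReal.ofReal (g (m' (x + h)) (m' x))) x) p₂]
    refine lintegral_mono fun x => ?_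
    by_cases hx : x ∈ K
    · have hx' : x - p₂ ∈ (Ω' : Set ℂ) := by
        refine Metric.mem_thickening_iff.2 ⟨x, hx, ?_⟩
        rw [dist_eq_norm, sub_sub_cancel_left, norm_neg]
        linarith
      have e : x - p₂ + h = x - p₁ := by rw [hh]; ring
      rw [indicator_of_mem hx, indicator_of_mem hx', e]
    · rw [indicator_of_notMem hx]; exact zero_le
  refine htr.trans (lintegral_mono_ae
    ((ae_restrict_iff' Ω'.isOpen.measurableSet).2 ?_))
  have hmm' : ∀ᵐ x : ℂ, x + h ∈ (Ω : Set ℂ) → m' (x + h) = m (x + h) :=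
    (measurePreserving_add_right volume h).quasiMeasurePreserving.ae hmm
  filter_upwards [hmm, hmm'] with x e1 e2 hx
  have hxΩ : x ∈ (Ω : Set ℂ) := hsub (Metric.thickening_subset_cthickening _ _ hx)
  have hxhΩ : x + h ∈ (Ω : Set ℂ) := by
    obtain ⟨y, hy, hxy⟩ := Metric.mem_thickening_iff.1 hx
    refine hδΩ (Metric.mem_cthickening_of_dist_le _ y _ _ hy ?_)
    calc dist (x + h) y ≤ dist (x + h) x + dist x y := dist_triangle _ _ _
      _ ≤ δ / 4 + δ / 2 := by
          gcongr
          rw [dist_eq_norm, add_sub_cancel_left]; exact hhn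
      _ ≤ δ := by linarith
  rw [e1 hxΩ, e2 hxhΩ]
  exact hg.le_anisoMetric _ _

/-- Mollifications of an eikonal solution satisfying the regularity estimate have entropy
productions which are bounded in `L¹` of every compact set. -/
theorem exists_lintegral_divergence_bound (hγ : IsArcLengthParam N L γ)
    (hN_def : ∀ z, N z = 0 → z = 0) {α : ℝ → ℝ} {g : ℂ → ℂ → ℝ} (hg : IsPairMinorant N L γ α g)
    {F : ℂ → ℂ} {ℓ : ℂ → ℝ} {B : ℝ} (hF : Differentiable ℝ F)
    (hFℓ : ∀ z, N z ≤ 1 → |ℓ z| ≤ B ∧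
      ‖fderiv ℝ F z - ℓ z • ContinuousLinearMap.id ℝ ℂ‖ ≤ B * (1 - N z)) {C : ℝ} (hC : 0 < C)
    {Ω : Opens ℂ} {m m' : ℂ → ℂ} (hreg : RegularityEstimate Ω L γ α m)
    (hm : Measurable m') (hm1 : ∀ x, N (m' x) = 1)
    (hdiv : ∀ ζ : 𝓓(Ω, ℝ), divPairing Ω m' ζ = 0)
    (hmm : ∀ᵐ x, x ∈ (Ω : Set ℂ) → m' x = m x)
    {K : Set ℂ} (hK : IsCompact K) (hKΩ : K ⊆ Ω) :
    ∃ δ > 0, ∃ M : ℝ≥0∞, M < ∞ ∧ ∀ (k : ℂ → ℝ) (ρ : ℝ), IsMollifier C k ρ → ρ ≤ δ →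
      ∫⁻ x in K, ENNReal.ofReal |divergence (fun y => F (mollify k m' y)) x| ≤ M := by
  obtain ⟨A, hA, hA'⟩ := hγ.exists_divergence_comp_mollify_le hN_def hg hF hFℓ hC
  obtain ⟨δ, hδ, M, hM, hδΩ, hM'⟩ := exists_translate_bound hg hreg hmm hK hKΩ
  obtain ⟨R, -, hR'⟩ := hγ.exists_norm_le
  obtain ⟨G, hG⟩ := hg.bounded
  refine ⟨δ, hδ, ENNReal.ofReal (2 * A) * M, ENNReal.mul_lt_top ENNReal.ofReal_lt_top hM,
    fun k ρ hk hρδ => ?_⟩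
  have hρ := hk.pos
  have := isProbabilityMeasure_ballMeasure hρ
  set ν := (ballMeasure ρ).prod (ballMeasure ρ) with hν
  have hgm : Measurable fun q : ℂ × (ℂ × ℂ) => g (m' (q.1 - q.2.1)) (m' (q.1 - q.2.2)) :=
    hg.measurable.comp ((hm.comp (measurable_fst.sub (measurable_fst.comp measurable_snd))).prodMk
      (hm.comp (measurable_fst.sub (measurable_snd.comp measurable_snd))))
  have hpt : ∀ x ∈ K, ENNReal.ofReal |divergence (fun y => F (mollify k m' y)) x| ≤
      ENNReal.ofReal (A / ρ) * ∫⁻ p, ENNReal.ofReal (g (m' (x - p.1)) (m' (x - p.2))) ∂ν := by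
    intro x hx
    have hball : Metric.closedBall x ρ ⊆ Ω := fun y hy =>
      hδΩ (Metric.mem_cthickening_of_dist_le y x δ K hx ((Metric.mem_closedBall.1 hy).trans hρδ))
    have h1 := (hA' k ρ hk m' hm hm1 x).2
      (hk.divergence_mollify_eq_zero hm (fun x => hR' _ (hm1 x)) hdiv hball)
    have hgx : Measurable fun p : ℂ × ℂ => g (m' (x - p.1)) (m' (x - p.2)) :=
      hgm.comp measurable_prodMk_left
    have hgi : Integrable (fun p : ℂ × ℂ => g (m' (x - p.1)) (m' (x - p.2))) ν :=
      Integrable.of_bound hgx.aestronglyMeasurable G (Filter.Eventually.of_forall fun p => by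
        rw [Real.norm_eq_abs, abs_of_nonneg (hg.nonneg _ _)]; exact hG _ _)
    rw [← ofReal_integral_eq_lintegral_ofReal hgi
      (Filter.Eventually.of_forall fun p => hg.nonneg _ _),
      ← ENNReal.ofReal_mul (by positivity)]
    exact ENNReal.ofReal_le_ofReal h1
  calc _ ≤ ∫⁻ x in K, ENNReal.ofReal (A / ρ) *
        ∫⁻ p, ENNReal.ofReal (g (m' (x - p.1)) (m' (x - p.2))) ∂ν :=
        setLIntegral_mono' hK.measurableSet hpt
    _ = ENNReal.ofReal (A / ρ) *
        ∫⁻ p, (∫⁻ x in K, ENNReal.ofReal (g (m' (x - p.1)) (m' (x - p.2)))) ∂ν := by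
        rw [lintegral_const_mul' _ _ ENNReal.ofReal_ne_top, lintegral_lintegral_swap]
        exact hgm.ennreal_ofReal.aemeasurable
    _ ≤ ENNReal.ofReal (A / ρ) * ∫⁻ _, M * ENNReal.ofReal (2 * ρ) ∂ν := by
        refine mul_le_mul' le_rfl (lintegral_mono_ae ?_)
        have h1 : ∀ᵐ t ∂(ballMeasure ρ), ‖t‖ ≤ ρ := by
          have := ProbabilityTheory.ae_cond_mem (μ := volume)
            (Metric.isClosed_closedBall (x := (0 : ℂ)) (ε := ρ)).measurableSet
          filter_upwards [this] with t ht
          exact mem_closedBall_zero_iff.1 ht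
        have h2 : ∀ᵐ p ∂ν, ‖p.1‖ ≤ ρ := Measure.quasiMeasurePreserving_fst.ae h1
        have h3 : ∀ᵐ p ∂ν, ‖p.2‖ ≤ ρ := Measure.quasiMeasurePreserving_snd.ae h1
        filter_upwards [h2, h3] with p hp1 hp2
        refine (hM' p.1 p.2 (hp1.trans hρδ) (hp2.trans hρδ)).trans ?_
        gcongr
        rw [← ofReal_norm]
        exact ENNReal.ofReal_le_ofReal ((_root_.norm_sub_le _ _).trans (by linarith))
    _ = ENNReal.ofReal (2 * A) * M := by
        rw [lintegral_const, measure_univ, mul_one, mul_comm M, ← mul_assoc,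
          ← ENNReal.ofReal_mul (by positivity)]
        congr 2
        field_simp

end IsArcLengthParam

/-! ### Limits of locally bounded sequences of functions -/

/-- Vague compactness: measures which are eventually bounded on every compact set converge, along
any ultrafilter finer than `atTop`, to a measure that is finite on compact sets. -/
theorem exists_measure_tendsto_of_bounded {X : Type*} [TopologicalSpace X] [T2Space X]
    [LocallyCompactSpace X] [MeasurableSpace X] [BorelSpace X] (lam : ℕ → Measure X)
    (h : ∀ K : Set X, IsCompact K → ∃ M : ℝ≥0∞, M < ∞ ∧ ∀ᶠ n in Filter.atTop, lam n K ≤ M)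
    (U : Ultrafilter ℕ) (hU : (U : Filter ℕ) ≤ Filter.atTop) :
    ∃ μ : Measure X, IsFiniteMeasureOnCompacts μ ∧
      ∀ φ : CompactlySupportedContinuousMap X ℝ,
        Filter.Tendsto (fun n => ∫ x, φ x ∂(lam n)) U (nhds (∫ x, φ x ∂μ)) := by
  have hint : ∀ φ : CompactlySupportedContinuousMap X ℝ, ∀ᶠ n in U, Integrable φ (lam n) := by
    intro φ
    obtain ⟨M, hM, hn⟩ := h _ φ.hasCompactSupport
    obtain ⟨B, hB⟩ := φ.continuous.bounded_above_of_compact_support φ.hasCompactSupport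
    filter_upwards [hU hn] with n hn
    rw [← integrableOn_iff_integrable_of_support_subset (subset_tsupport φ)]
    exact Measure.integrableOn_of_bounded (hn.trans_lt hM).ne
      φ.continuous.aestronglyMeasurable
      (Filter.Eventually.of_forall hB)
  have hlim : ∀ φ : CompactlySupportedContinuousMap X ℝ,
      ∃ a, Filter.Tendsto (fun n => ∫ x, φ x ∂(lam n)) U (nhds a) := by
    intro φ
    obtain ⟨M, hM, hn⟩ := h _ φ.hasCompactSupport
    obtain ⟨B, hB⟩ := φ.continuous.bounded_above_of_compact_support φ.hasCompactSupport
    have hev : ∀ᶠ n in U, ∫ x, φ x ∂(lam n) ∈ Metric.closedBall (0 : ℝ) (|B| * M.toReal) := by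
      filter_upwards [hU hn] with n hn
      rw [mem_closedBall_zero_iff,
        ← setIntegral_eq_integral_of_forall_compl_eq_zero (s := tsupport φ)
          (fun x hx => image_eq_zero_of_notMem_tsupport hx)]
      refine (norm_setIntegral_le_of_norm_le_const (hn.trans_lt hM)
        fun x _ => (hB x).trans (le_abs_self B)).trans ?_
      exact mul_le_mul_of_nonneg_left (ENNReal.toReal_mono hM.ne hn) (abs_nonneg B)
    obtain ⟨a, -, ha⟩ := (isCompact_closedBall (0 : ℝ) (|B| * M.toReal)).ultrafilter_le_nhds
      (U.map fun n => ∫ x, φ x ∂(lam n)) (Filter.le_principal_iff.2 hev)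
    exact ⟨a, ha⟩
  choose Λ hΛ using hlim
  let Λl : CompactlySupportedContinuousMap X ℝ →ₗ[ℝ] ℝ :=
    { toFun := Λ
      map_add' := fun φ ψ => by
        refine tendsto_nhds_unique (hΛ (φ + ψ)) (((hΛ φ).add (hΛ ψ)).congr' ?_)
        filter_upwards [hint φ, hint ψ] with n h1 h2
        exact (integral_add h1 h2).symm
      map_smul' := fun c φ => by
        refine tendsto_nhds_unique (hΛ (c • φ)) (((hΛ φ).const_smul c).congr fun n => ?_)
        exact (integral_smul c _).symm }
  let Λp : CompactlySupportedContinuousMap X ℝ →ₚ[ℝ] ℝ := PositiveLinearMap.mk₀ Λl fun φ hφ =>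
    ge_of_tendsto (hΛ φ) (Filter.Eventually.of_forall fun n => integral_nonneg fun x => hφ x)
  refine ⟨RealRMK.rieszMeasure Λp, inferInstance, fun φ => ?_⟩
  rw [RealRMK.integral_rieszMeasure]
  exact hΛ φ

/-- A distribution which is a limit of functions bounded in `L¹` of every compact set is a
difference of two locally finite measures. -/
theorem exists_measures_of_bounded {Ω : Opens ℂ} (f : ℕ → ℂ → ℝ) (hf : ∀ n, Measurable (f n))
    (hb : ∀ K : Set ℂ, IsCompact K → K ⊆ Ω → ∃ M : ℝ≥0∞, M < ∞ ∧
      ∀ᶠ n in Filter.atTop, ∫⁻ x in K, ENNReal.ofReal |f n x| ≤ M) :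
    ∃ μ ν : Measure ℂ, (∀ K : Set ℂ, IsCompact K → K ⊆ Ω → μ K < ∞ ∧ ν K < ∞) ∧
      ∀ ζ : 𝓓(Ω, ℝ), ∀ a : ℝ, Filter.Tendsto (fun n => ∫ x, ζ x * f n x) Filter.atTop (nhds a) →
        a = (∫ x in (Ω : Set ℂ), ζ x ∂μ) - ∫ x in (Ω : Set ℂ), ζ x ∂ν := by
  have hΩm : MeasurableSet (Ω : Set ℂ) := Ω.isOpen.measurableSet
  have hemb : MeasurableEmbedding (Subtype.val : Ω → ℂ) := MeasurableEmbedding.subtype_coe hΩm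
  have : LocallyCompactSpace Ω := Ω.isOpen.locallyCompactSpace
  have hUle : ((Filter.hyperfilter ℕ : Ultrafilter ℕ) : Filter ℕ) ≤ Filter.atTop :=
    Nat.hyperfilter_le_atTop
  have key : ∀ g : ℕ → ℂ → ℝ, (∀ n, Measurable (g n)) → (∀ n x, |g n x| = |f n x|) →
      ∃ μ : Measure ℂ, (∀ K : Set ℂ, IsCompact K → K ⊆ Ω → μ K < ∞) ∧
        ∀ ζ : 𝓓(Ω, ℝ), Filter.Tendsto (fun n => ∫ x, ζ x * max (g n x) 0)
          (Filter.hyperfilter ℕ : Ultrafilter ℕ) (nhds (∫ x in (Ω : Set ℂ), ζ x ∂μ)) := by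
    intro g hg hgf
    obtain ⟨μ, hμ, hμt⟩ := exists_measure_tendsto_of_bounded (X := Ω)
      (fun n => (volume.withDensity fun x => ENNReal.ofReal (g n x)).comap Subtype.val)
      (fun K hK => by
        have hK' := hK.image continuous_subtype_val
        obtain ⟨M, hM, hn⟩ := hb _ hK' (by rintro _ ⟨x, -, rfl⟩; exact x.2)
        refine ⟨M, hM, ?_⟩
        filter_upwards [hn] with n hn
        rw [hemb.comap_apply, withDensity_apply _ hK'.measurableSet]
        refine le_trans (lintegral_mono fun x => ENNReal.ofReal_le_ofReal ?_) hn
        rw [← hgf]; exact le_abs_self _) (Filter.hyperfilter ℕ) hUle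
    refine ⟨μ.map Subtype.val, fun K hK hKΩ => ?_, fun ζ => ?_⟩
    · rw [hemb.map_apply]
      refine IsCompact.measure_lt_top ?_
      rw [Topology.IsInducing.subtypeVal.isCompact_preimage_iff (by simpa using hKΩ)]
      exact hK
    · have hφc : HasCompactSupport fun x : Ω => ζ x := by
        have h1 : IsCompact ((Subtype.val : Ω → ℂ) ⁻¹' tsupport ζ) := by
          rw [Topology.IsInducing.subtypeVal.isCompact_preimage_iff
            (by simpa using ζ.tsupport_subset)]
          exact ζ.hasCompactSupport
        refine h1.of_isClosed_subset (isClosed_tsupport _) ?_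
        refine closure_minimal (fun x hx => subset_tsupport _ hx) ?_
        exact (isClosed_tsupport ζ).preimage continuous_subtype_val
      have ht := hμt ⟨⟨fun x : Ω => ζ x, ζ.continuous.comp continuous_subtype_val⟩, hφc⟩
      have e1 : ∫ x in (Ω : Set ℂ), ζ x ∂(μ.map Subtype.val) = ∫ x : Ω, ζ x ∂μ := by
        have hpre : (Subtype.val : Ω → ℂ) ⁻¹' (Ω : Set ℂ) = univ := by ext x; simp
        rw [hemb.setIntegral_map, hpre, Measure.restrict_univ]
      rw [e1]
      refine Filter.Tendsto.congr (fun n => ?_) ht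
      change ∫ x : Ω, ζ x ∂((volume.withDensity fun x => ENNReal.ofReal (g n x)).comap
        Subtype.val) = _
      have e2 := integral_subtype_comap
        (μ := volume.withDensity fun x => ENNReal.ofReal (g n x)) hΩm (fun x => ζ x)
      refine e2.trans ?_
      rw [setIntegral_withDensity_eq_setIntegral_toReal_smul (hg n).ennreal_ofReal
        (Filter.Eventually.of_forall fun _ => ENNReal.ofReal_lt_top) _ hΩm,
        setIntegral_eq_integral_of_forall_compl_eq_zero]
      · congr 1; funext x
        rw [ENNReal.toReal_ofReal', smul_eq_mul, mul_comm]
      · intro x hx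
        rw [image_eq_zero_of_notMem_tsupport fun h => hx (ζ.tsupport_subset h), smul_zero]
  obtain ⟨μ, hμ, hμt⟩ := key f hf fun _ _ => rfl
  obtain ⟨ν, hν, hνt⟩ := key (fun n x => -f n x) (fun n => (hf n).neg) fun _ _ => abs_neg _
  refine ⟨μ, ν, fun K hK hKΩ => ⟨hμ K hK hKΩ, hν K hK hKΩ⟩, fun ζ a ha => ?_⟩
  refine tendsto_nhds_unique (ha.mono_left hUle) (((hμt ζ).sub (hνt ζ)).congr' ?_)
  obtain ⟨M, hM, hn⟩ := hb _ ζ.hasCompactSupport ζ.tsupport_subset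
  obtain ⟨B, hB⟩ := ζ.continuous.bounded_above_of_compact_support ζ.hasCompactSupport
  filter_upwards [hUle hn] with n hn
  have hfi : IntegrableOn (f n) (tsupport ζ) := by
    refine ⟨(hf n).aestronglyMeasurable, ?_⟩
    rw [hasFiniteIntegral_iff_norm]
    exact hn.trans_lt hM
  have hi : ∀ g : ℂ → ℝ, Measurable g → (∀ x, |g x| ≤ |f n x|) →
      Integrable fun x => ζ x * g x := by
    intro g hg hgf
    rw [← integrableOn_iff_integrable_of_support_subset
      ((Function.support_mul_subset_left _ _).trans (subset_tsupport ζ))]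
    refine (hfi.norm.const_mul B).mono'
      (ζ.continuous.measurable.mul hg).aestronglyMeasurable
      (Filter.Eventually.of_forall fun x => ?_)
    rw [norm_mul]
    have hB0 := (norm_nonneg _).trans (hB x)
    have := hgf x
    gcongr
    · exact hB x
    · exact this
  rw [← integral_sub]
  · congr 1; funext x
    rcases le_total (f n x) 0 with h | h
    · rw [max_eq_right h, max_eq_left (by linarith)]; ring
    · rw [max_eq_left h, max_eq_right (by linarith)]; ring
  · refine hi _ ((hf n).max measurable_const) fun x => ?_
    rw [abs_of_nonneg (le_max_right _ _)]
    exact max_le (le_abs_self _) (abs_nonneg _)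
  · refine hi _ ((hf n).neg.max measurable_const) fun x => ?_
    rw [abs_of_nonneg (le_max_right _ _)]
    exact max_le (neg_le_abs _) (abs_nonneg _)

/-! ### Entropy productions as limits -/

lemma fderiv_re_apply {G : ℂ → ℂ} {x : ℂ} (hG : DifferentiableAt ℝ G x) (v : ℂ) :
    fderiv ℝ (fun y => (G y).re) x v = (fderiv ℝ G x v).re := by
  have h := (Complex.reCLM.hasFDerivAt.comp x hG.hasFDerivAt).fderiv
  have e : fderiv ℝ (fun y => (G y).re) x = Complex.reCLM.comp (fderiv ℝ G x) := h
  rw [e]; rfl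

lemma fderiv_im_apply {G : ℂ → ℂ} {x : ℂ} (hG : DifferentiableAt ℝ G x) (v : ℂ) :
    fderiv ℝ (fun y => (G y).im) x v = (fderiv ℝ G x v).im := by
  have h := (Complex.imCLM.hasFDerivAt.comp x hG.hasFDerivAt).fderiv
  have e : fderiv ℝ (fun y => (G y).im) x = Complex.imCLM.comp (fderiv ℝ G x) := h
  rw [e]; rfl

lemma clm_apply_eq_re_add_im (A : ℂ →L[ℝ] ℝ) (z : ℂ) :
    A z = A 1 * z.re + A Complex.I * z.im := by
  have hz : z = z.re • (1 : ℂ) + z.im • Complex.I := by simp [Complex.re_add_im]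
  conv_lhs => rw [hz, map_add, map_smul, map_smul]
  simp only [smul_eq_mul]
  ring

lemma measurable_divergence (G : ℂ → ℂ) : Measurable (divergence G) :=
  (Complex.measurable_re.comp (measurable_fderiv_apply_const ℝ G 1)).add
    (Complex.measurable_im.comp (measurable_fderiv_apply_const ℝ G Complex.I))

/-- Integration by parts against a test function. -/
lemma integral_mul_divergence {ζ : ℂ → ℝ} (hζ : ContDiff ℝ 1 ζ) (hc : HasCompactSupport ζ)
    {G : ℂ → ℂ} (hG : Differentiable ℝ G) {M : ℝ} (hM : ∀ x, ‖fderiv ℝ G x‖ ≤ M) :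
    ∫ x, ζ x * divergence G x = -∫ x, fderiv ℝ ζ x (G x) := by
  have hGc := hG.continuous
  have hdc : ∀ v, Continuous fun x => fderiv ℝ ζ x v := fun v =>
    (hζ.continuous_fderiv one_ne_zero).clm_apply continuous_const
  have hds : ∀ v, HasCompactSupport fun x => fderiv ℝ ζ x v := fun v => hc.fderiv_apply ℝ v
  have hMv : ∀ x v, ‖fderiv ℝ G x v‖ ≤ M * ‖v‖ := fun x v =>
    ((fderiv ℝ G x).le_opNorm v).trans (by gcongr; exact hM x)
  have hre : ∫ x, ζ x * (fderiv ℝ G x 1).re = -∫ x, fderiv ℝ ζ x 1 * (G x).re := by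
    have h := integral_mul_fderiv_eq_neg_fderiv_mul_of_integrable (μ := volume) (f := ζ)
      (g := fun x => (G x).re) (v := 1) ?_ ?_ ?_ (fun x _ => hζ.differentiable one_ne_zero x)
      (fun x _ => (Complex.reCLM.differentiableAt.comp x (hG x)))
    · simpa only [fderiv_re_apply (hG _)] using h
    · exact ((hdc 1).mul (Complex.continuous_re.comp hGc)).integrable_of_hasCompactSupport
        (hds 1).mul_right
    · simp only [fderiv_re_apply (hG _)]
      refine integrable_smul_of_bounded (M := M * ‖(1 : ℂ)‖) hζ.continuous hc
        (Complex.measurable_re.comp (measurable_fderiv_apply_const ℝ G 1)) fun x =>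
          (Complex.abs_re_le_norm _).trans (hMv x 1)
    · exact (hζ.continuous.mul (Complex.continuous_re.comp hGc)).integrable_of_hasCompactSupport
        hc.mul_right
  have him : ∫ x, ζ x * (fderiv ℝ G x Complex.I).im = -∫ x, fderiv ℝ ζ x Complex.I * (G x).im := by
    have h := integral_mul_fderiv_eq_neg_fderiv_mul_of_integrable (μ := volume) (f := ζ)
      (g := fun x => (G x).im) (v := Complex.I) ?_ ?_ ?_
      (fun x _ => hζ.differentiable one_ne_zero x)
      (fun x _ => (Complex.imCLM.differentiableAt.comp x (hG x)))
    · simpa only [fderiv_im_apply (hG _)] using h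
    · exact ((hdc Complex.I).mul
        (Complex.continuous_im.comp hGc)).integrable_of_hasCompactSupport (hds Complex.I).mul_right
    · simp only [fderiv_im_apply (hG _)]
      refine integrable_smul_of_bounded (M := M * ‖Complex.I‖) hζ.continuous hc
        (Complex.measurable_im.comp (measurable_fderiv_apply_const ℝ G Complex.I)) fun x =>
          (Complex.abs_im_le_norm _).trans (hMv x Complex.I)
    · exact (hζ.continuous.mul (Complex.continuous_im.comp hGc)).integrable_of_hasCompactSupport
        hc.mul_right
  have i1 : Integrable fun x => ζ x * (fderiv ℝ G x 1).re :=
    integrable_smul_of_bounded (M := M * ‖(1 : ℂ)‖) hζ.continuous hc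
      (Complex.measurable_re.comp (measurable_fderiv_apply_const ℝ G 1)) fun x =>
        (Complex.abs_re_le_norm _).trans (hMv x 1)
  have i2 : Integrable fun x => ζ x * (fderiv ℝ G x Complex.I).im :=
    integrable_smul_of_bounded (M := M * ‖Complex.I‖) hζ.continuous hc
      (Complex.measurable_im.comp (measurable_fderiv_apply_const ℝ G Complex.I)) fun x =>
        (Complex.abs_im_le_norm _).trans (hMv x Complex.I)
  have j1 : Integrable fun x => fderiv ℝ ζ x 1 * (G x).re :=
    ((hdc 1).mul (Complex.continuous_re.comp hGc)).integrable_of_hasCompactSupport (hds 1).mul_right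
  have j2 : Integrable fun x => fderiv ℝ ζ x Complex.I * (G x).im :=
    ((hdc Complex.I).mul (Complex.continuous_im.comp hGc)).integrable_of_hasCompactSupport
      (hds Complex.I).mul_right
  simp only [divergence, mul_add, clm_apply_eq_re_add_im _ (G _)]
  rw [integral_add i1 i2, integral_add j1 j2, hre, him]
  ring

theorem theorem1p7
    (N : Seminorm ℝ ℂ) (hN_def : ∀ z, N z = 0 → z = 0)
    (hN_strict : StrictConvex ℝ {z : ℂ | N z ≤ 1})
    (hN_analytic : AnalyticOnNhd ℝ (fun z : ℂ => N z) {0}ᶜ)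
    (L : ℝ) (γ : ℝ → ℂ) (hγ : IsArcLengthParam N L γ)
    (α : ℝ → ℝ) (hα : IsTangentAngle γ α)
    (Ω : Opens ℂ) (hΩ : Bornology.IsBounded (Ω : Set ℂ))
    (m : ℂ → ℂ) (hm : IsEikonalSolution N Ω m)
    (hreg : RegularityEstimate Ω L γ α m) :
    ∀ Φ : ℂ → ℂ, IsEntropy L γ Φ →
      DivIsLocallyFiniteMeasure Ω (fun x => Φ (m x)) := by
  intro Φ hΦ
  obtain ⟨g, hg⟩ := hγ.exists_isPairMinorant hN_strict hα
  obtain ⟨F, ℓ, B, hB, hFΦ, hF, hFℓ⟩ := hγ.exists_entropy_extension hN_def hΦ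
  obtain ⟨C, hC, hmol⟩ := exists_isMollifier_scaledBump
  obtain ⟨m', hm', hm1, hmm⟩ := hγ.exists_representative hm
  obtain ⟨R, hR, hR'⟩ := hγ.exists_norm_le
  have hmR : ∀ x, ‖m' x‖ ≤ R := fun x => hR' _ (hm1 x)
  have hmm_ae : ∀ᵐ x ∂(volume.restrict (Ω : Set ℂ)), m' x = m x :=
    (ae_restrict_iff' Ω.isOpen.measurableSet).2 hmm
  have hdiv : ∀ ζ : 𝓓(Ω, ℝ), divPairing Ω m' ζ = 0 := fun ζ => by
    rw [← hm.div_eq_zero ζ, divPairing, divPairing]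
    congr 1
    exact integral_congr_ae (by filter_upwards [hmm_ae] with x hx; rw [hx])
  obtain ⟨A, hA, hA'⟩ := hγ.exists_divergence_comp_mollify_le hN_def hg hF hFℓ hC
  have hpos : ∀ n : ℕ, (0 : ℝ) < 1 / (n + 1) := fun n => by positivity
  set φ : ℕ → ContDiffBump (0 : ℂ) := fun n => scaledBump (1 / (n + 1)) (hpos n)
  set G : ℕ → ℂ → ℂ := fun n x => F (mollify ((φ n).normed volume) m' x) with hGdef
  have hk : ∀ n, IsMollifier C ((φ n).normed volume) (2 * (1 / ((n : ℝ) + 1))) :=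
    fun n => hmol _ (hpos n)
  have hGd : ∀ n, Differentiable ℝ (G n) := fun n =>
    hF.comp ((hk n).differentiable_mollify hm' hmR)
  have hrad : Filter.Tendsto (fun n : ℕ => 2 * (1 / ((n : ℝ) + 1))) Filter.atTop (nhds 0) := by
    simpa using tendsto_one_div_add_atTop_nhds_zero_nat.const_mul (2 : ℝ)
  obtain ⟨μ, ν, hfin, hμν⟩ := exists_measures_of_bounded (Ω := Ω) (fun n => divergence (G n))
    (fun n => measurable_divergence _) fun K hK hKΩ => by
      obtain ⟨δ, hδ, M, hM, h⟩ := hγ.exists_lintegral_divergence_bound hN_def hg hF hFℓ hC hreg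
        hm' hm1 hdiv hmm hK hKΩ
      refine ⟨M, hM, ?_⟩
      filter_upwards [hrad.eventually (Iic_mem_nhds hδ)] with n hn
      exact h _ _ (hk n) hn
  refine ⟨μ, ν, hfin, fun ζ => hμν ζ _ ?_⟩
  have hζ1 : ContDiff ℝ 1 ζ := ζ.contDiff.of_le (by simp)
  have hpair : divPairing Ω (fun x => Φ (m x)) ζ = -∫ x, fderiv ℝ ζ x (F (m' x)) := by
    have hset : ∫ x in (Ω : Set ℂ), fderiv ℝ ζ x (F (m' x)) = ∫ x, fderiv ℝ ζ x (F (m' x)) := by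
      refine setIntegral_eq_integral_of_forall_compl_eq_zero fun x hx => ?_
      have h0 : fderiv ℝ ζ x = 0 := image_eq_zero_of_notMem_tsupport fun h =>
        hx (ζ.tsupport_subset (tsupport_fderiv_subset ℝ h))
      rw [h0, zero_apply]
    rw [divPairing, ← hset]
    congr 1
    refine integral_congr_ae ?_
    filter_upwards [hmm_ae] with x hx
    rw [← hx, hFΦ _ (hm1 x)]
  rw [hpair]
  have hparts : ∀ n, ∫ x, ζ x * divergence (G n) x = -∫ x, fderiv ℝ ζ x (G n x) := fun n =>
    integral_mul_divergence hζ1 ζ.hasCompactSupport (hGd n)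
      fun x => (hA' _ _ (hk n) m' hm' hm1 x).1
  simp only [hparts]
  refine Filter.Tendsto.neg ?_
  -- the extended entropy is bounded on the unit ball
  obtain ⟨T, hT⟩ : ∃ T, ∀ z, N z ≤ 1 → ‖F z‖ ≤ T := by
    have hcpt : IsCompact ((fun p : ℝ × ℝ => p.1 • γ p.2) '' (Icc 0 1 ×ˢ Icc 0 L)) :=
      (isCompact_Icc.prod isCompact_Icc).image
        (continuous_fst.smul (hγ.contDiff.continuous.comp continuous_snd))
    obtain ⟨T, hT⟩ := hcpt.exists_bound_of_continuousOn hF.continuous.continuousOn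
    refine ⟨T, fun z hz => hT z ?_⟩
    obtain ⟨θ, hθ⟩ := hγ.exists_radial hN_def z
    obtain ⟨θ', hθ', e⟩ := hγ.exists_param (hγ.norm_eq_one θ)
    exact ⟨(N z, θ'), ⟨⟨apply_nonneg N z, hz⟩, Ico_subset_Icc_self hθ'⟩, by
      simp only [e]; exact hθ.symm⟩
  have hdζ : Continuous (fderiv ℝ ζ) := hζ1.continuous_fderiv one_ne_zero
  refine tendsto_integral_of_dominated_convergence (fun x => ‖fderiv ℝ ζ x‖ * T) (fun n => ?_) ?_
    (fun n => ?_) ?_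
  · exact (hdζ.clm_apply (hGd n).continuous).aestronglyMeasurable
  · exact (hdζ.norm.integrable_of_hasCompactSupport
      (ζ.hasCompactSupport.fderiv ℝ).norm).mul_const T
  · refine Filter.Eventually.of_forall fun x => ((fderiv ℝ ζ x).le_opNorm _).trans ?_
    gcongr
    exact hT _ (hγ.norm_mollify_le_one hN_def (hk n) hm' hm1 x)
  · have hconv := ContDiffBump.ae_convolution_tendsto_right_of_locallyIntegrable (μ := volume)
      (φ := φ) (l := Filter.atTop) (K := 2) hrad
      (Filter.Eventually.of_forall fun n => le_rfl) (locallyIntegrable_of_bounded hm' hmR)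
    filter_upwards [hconv] with x hx
    exact ((fderiv ℝ ζ x).continuous.tendsto _).comp ((hF.continuous.tendsto _).comp hx)
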